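/- Let $n,m,t$ be positive integers and let $k,\varepsilon>0$ be reals. All Hilbert spaces are finite-dimensional, $\|\cdot\|_1$ is the trace norm, $U_m$ is the uniform distribution on $\{0,1\}^m$, and classical registers are read in the computational basis. **Extractors.** A pure state $\sigma$ on registers $X\hat XNMY\hat Y$, with $X,\hat X,Y,\hat Y$ holding $n$-bit strings, is a $(k_1,k_2)$-qma-state if $X,Y$ are classical with copies $\hat X,\hat Y$ and $H_{\min}(X|MY\hat Y)_\sigma\ge k_1$, $H_{\min}(Y|NX\hat X)_\sigma\ge k_2$, where $H_{\min}(A|E)_\rho=-\inf\{\lambda\in\mathbb R:\rho_{AE}\le 2^{\lambda}\,\mathrm{id}_A\otimes\tau_E\text{ for some state }\tau_E\}$. A $(t;k_1,k_2)$-qnm-state is a state $\rho=(U\otimes V)\sigma(U\otimes V)^\dagger$ with $\sigma$ a $(k_1,k_2)$-qma-state and $U:XN\to XX^{[t]}\hat X^{[t]}N'$, $V:YM\to YY^{[t]}\hat Y^{[t]}M'$ isometries that are safe on $X$ and $Y$ respectively (that is, controlled by the basis value of that register, which they leave unchanged), such that $X^{[t]}=(X^1,\dots,X^t)$ and $Y^{[t]}=(Y^1,\dots,Y^t)$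 are classical tuples of $n$-bit strings with copies $\hat X^{[t]},\hat Y^{[t]}$, and for every $i\in\{1,\dots,t\}$, $\Pr(X\ne X^i)_\rho=1$ or $\Pr(Y\ne Y^i)_\rho=1$. A function $\mathrm{ext}:\{0,1\}^n\times\{0,1\}^n\to\{0,1\}^m$ is a $(t;k_1,k_2,\varepsilon)$-quantum secure 2-source $t$-non-malleable extractor if for every $(t;k_1,k_2)$-qnm-state $\rho$, writing $S=\mathrm{ext}(X,Y)$ and $S^{[t]}=(\mathrm{ext}(X^i,Y^i))_{i}$, $$\|\rho_{SS^{[t]}XX^{[t]}N'}-U_m\otimes\rho_{S^{[t]}XX^{[t]}N'}\|_1\le\varepsilon\quad\text{and}\quad\|\rho_{SS^{[t]}YY^{[t]}M'}-U_m\otimes\rho_{S^{[t]}YY^{[t]}M'}\|_1\le\varepsilon.$$ **Codes.** Let $\mathrm{Enc}:\{0,1\}^m\to\{0,1\}^n\times\{0,1\}^n$ be a randomized function and $\mathrm{Dec}:\{0,1\}^n\times\{0,1\}^n\to\{0,1\}^m\cup\{\mathsf{same}\}$ a function. The pair $(\mathrm{Enc},\mathrm{Dec})$ is a $(t;m,n,\varepsilon')$-quantum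 secure one-many non-malleable code in the split-state model if $\Pr(\mathrm{Dec}(\mathrm{Enc}(s))=s)=1$ for every $s\in\{0,1\}^m$, and for every adversary $\mathcal A=(U,V,\psi)$, consisting of a pure state $\psi_{NM}$ and isometries $U:XN\to X^{[t]}N'$, $V:YM\to Y^{[t]}M'$, there is a random variable $\mathcal D_{\mathcal A}$ on $(\{0,1\}^m\cup\{\mathsf{same}\})^t$ such that $$\|\rho_{S\,\mathrm{Dec}(X^1,Y^1)\cdots\mathrm{Dec}(X^t,Y^t)}-Z\,\mathsf{copy}^{(t)}(\mathcal D_{\mathcal A},Z)\|_1\le\varepsilon'.$$ Here $\rho$ is the state obtained from a uniform message $S$ and $(X,Y)=\mathrm{Enc}(S)$ by applying $U\otimes V$ to $(X,Y)$ and $\psi$, and then measuring $X^{[t]},Y^{[t]}$ in the computational basis; $Z=U_m$ is independent of $\mathcal D_{\mathcal A}$; and $\mathsf{copy}^{(t)}(d,z)$ replaces each entry $\mathsf{same}$ of the tuple $d$ by $z$. **Theorem.** Let $\mathrm{ext}:\{0,1\}^n\times\{0,1\}^n\to\{0,1\}^m$ be a surjective $(t;n-k,n-k,\varepsilon)$-quantum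 secure 2-source $t$-non-malleable extractor. Let $\mathrm{Enc}(s)$ be a uniformly random element of $\mathrm{ext}^{-1}(s)$, and let $\mathrm{Dec}(x,y)=\mathrm{ext}(x,y)$. Then $(\mathrm{Enc},\mathrm{Dec})$ is a $(t;m,n,\varepsilon')$-quantum secure one-many non-malleable code in the split-state model with $\varepsilon'=2^{2t}(2^{-k}+\varepsilon)+\varepsilon$; in particular, such a code exists. -/

import Mathlib

open scoped Matrix Kronecker ComplexOrder

noncomputable section

namespace SplitState

/-- Bit strings of length `n`. -/
abbrev Bits (n : ℕ) : Type := Fin n → Bool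

/-! ### Finite-dimensional quantum information

A register with computational basis `ι` (a finite type) has Hilbert space `ℂ^ι`.  Vectors are functions
`ι → ℂ`, operators are matrices, and a composite register is indexed by a product type. -/

section Quantum

variable {ι A B E X : Type} [Fintype ι] [Fintype A] [Fintype B] [Fintype E] [Fintype X]

/-- Unit vector, i.e. a pure state. -/
def IsPureState (ψ : ι → ℂ) : Prop := ∑ i, ‖ψ i‖ ^ 2 = 1

/-- Density matrix. -/
def IsState (ρ : Matrix ι ι ℂ) : Prop := ρ.PosSemidef ∧ ρ.trace = 1

/-- Isometry `ℂ^A → ℂ^B`. -/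
def IsIsometry [DecidableEq A] (V : Matrix B A ℂ) : Prop := Vᴴ * V = 1

/-- An operator `ℂ^X ⊗ ℂ^A → ℂ^X ⊗ ℂ^B` is safe on `X` if it applies an isometry to `A` controlled by the
basis value of `X`. -/
def IsSafe [DecidableEq A] [DecidableEq X] (V : Matrix (X × B) (X × A) ℂ) : Prop :=
  ∃ W : X → Matrix B A ℂ, (∀ x, IsIsometry (W x)) ∧
    ∀ x' b x a, V (x', b) (x, a) = if x' = x then W x b a else 0

/-- Probability of the event `S` when the pure state `ψ` is measured in the computational basis. -/
def prob (ψ : ι → ℂ) (S : Set ι) : ℝ := ∑ i, S.indicator (fun i => ‖ψ i‖ ^ 2) i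

/-- Marginal on `A` of the pure state `ψ` on `A ⊗ B`, i.e. `Tr_B |ψ⟩⟨ψ|`. -/
def marginal (ψ : A × B → ℂ) : Matrix A A ℂ :=
  Matrix.of fun a a' => ∑ b, ψ (a, b) * star (ψ (a', b))

/-- Partial trace over the first factor. -/
def traceFst (ρ : Matrix (A × B) (A × B) ℂ) : Matrix B B ℂ :=
  Matrix.of fun b b' => ∑ a, ρ (a, b) (a, b')

open Classical in
/-- Schatten 1-norm `Tr √(Mᴴ M)`: the sum of the square roots of the eigenvalues of `Mᴴ M`. -/
def traceNorm (M : Matrix ι ι ℂ) : ℝ :=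
  ∑ i, Real.sqrt ((Matrix.isHermitian_conjTranspose_mul_self M).eigenvalues i)

/-- Conditional min-entropy `H_min(A|E)`:  minus the infimum, over states `τ` of `E`, of the
max-divergence of `ρ` relative to `1 ⊗ τ`, which is the least `l` with `ρ ≤ 2^l (1 ⊗ τ)`. -/
def condMinEntropy [DecidableEq A] (ρ : Matrix (A × E) (A × E) ℂ) : ℝ :=
  -sInf {l : ℝ | ∃ τ : Matrix E E ℂ, IsState τ ∧
    ((((2 : ℝ) ^ l : ℝ) : ℂ) • ((1 : Matrix A A ℂ) ⊗ₖ τ) - ρ).PosSemidef}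

/-- A probability distribution as a (diagonal) quantum state. -/
def classicalState [DecidableEq ι] (p : PMF ι) : Matrix ι ι ℂ :=
  Matrix.diagonal fun i => ((p i).toReal : ℂ)

/-- The uniform distribution `U_m`. -/
def uniform (m : ℕ) : PMF (Bits m) := PMF.uniformOfFintype (Bits m)

end Quantum

/-! ### Two-source non-malleable extractors -/

section Extractor

variable {n m t : ℕ} {N M N' M' : Type} [Fintype N] [Fintype M] [Fintype N'] [Fintype M']
  [DecidableEq N] [DecidableEq M] [DecidableEq N'] [DecidableEq M']

/-- `(k₁,k₂)`-qma-state.  The registers are, in this order, `X, X̂, N, M, Y, Ŷ`; in the computational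
basis `X = X̂` and `Y = Ŷ` with certainty (so `X`, `Y` are classical with copies `X̂`, `Ŷ`), and
`H_min(X | M Y Ŷ) ≥ k₁`, `H_min(Y | N X X̂) ≥ k₂`. -/
def IsQMAState (k₁ k₂ : ℝ) (σ : Bits n × Bits n × N × M × Bits n × Bits n → ℂ) : Prop :=
  IsPureState σ ∧
  prob σ {(x, x', _, _, y, y') : Bits n × Bits n × N × M × Bits n × Bits n | x = x' ∧ y = y'} = 1 ∧
  k₁ ≤ condMinEntropy (A := Bits n) (E := M × Bits n × Bits n)
    (marginal (B := Bits n × N) fun ((x, c, y, y'), (x', a)) => σ (x, x', a, c, y, y')) ∧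
  k₂ ≤ condMinEntropy (A := Bits n) (E := N × Bits n × Bits n)
    (marginal (B := Bits n × M) fun ((y, a, x, x'), (y', c)) => σ (x, x', a, c, y, y'))

/-- Basis of the registers `X, X̂, X^[t], X̂^[t], N', M', Y, Ŷ, Y^[t], Ŷ^[t]` after tampering. -/
abbrev TamperedBasis (t n : ℕ) (N' M' : Type) : Type :=
  Bits n × Bits n × (Fin t → Bits n) × (Fin t → Bits n) × N' ×
    M' × Bits n × Bits n × (Fin t → Bits n) × (Fin t → Bits n)

/-- The vector `(U ⊗ V) σ`, where `U : X N → X X^[t] X̂^[t] N'` and `V : Y M → Y Y^[t] Ŷ^[t] M'`. -/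
def tamper (U : Matrix (Bits n × (Fin t → Bits n) × (Fin t → Bits n) × N') (Bits n × N) ℂ)
    (V : Matrix (Bits n × (Fin t → Bits n) × (Fin t → Bits n) × M') (Bits n × M) ℂ)
    (σ : Bits n × Bits n × N × M × Bits n × Bits n → ℂ) : TamperedBasis t n N' M' → ℂ :=
  fun (x, x', xs, xs', a', c', y, y', ys, ys') =>
    ∑ x₀, ∑ a, ∑ y₀, ∑ c, U (x, xs, xs', a') (x₀, a) * V (y, ys, ys', c') (y₀, c) *
      σ (x₀, x', a, c, y₀, y')

/-- `(t;k₁,k₂)`-qnm-state: obtained from a `(k₁,k₂)`-qma-state by isometries `U`, `V` that are safe on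
`X`, `Y`, with `X^[t] Y^[t]` classical with copy `X̂^[t] Ŷ^[t]`, and such that for each `i` the tampering
has almost surely no fixed point in `Y` or almost surely no fixed point in `X`. -/
def IsQNMState (k₁ k₂ : ℝ) (ρ : TamperedBasis t n N' M' → ℂ) : Prop :=
  ∃ (N M : Type) (_ : Fintype N) (_ : Fintype M) (_ : DecidableEq N) (_ : DecidableEq M)
    (σ : Bits n × Bits n × N × M × Bits n × Bits n → ℂ)
    (U : Matrix (Bits n × (Fin t → Bits n) × (Fin t → Bits n) × N') (Bits n × N) ℂ)
    (V : Matrix (Bits n × (Fin t → Bits n) × (Fin t → Bits n) × M') (Bits n × M) ℂ),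
    IsQMAState k₁ k₂ σ ∧ IsIsometry U ∧ IsIsometry V ∧ IsSafe U ∧ IsSafe V ∧
    ρ = tamper U V σ ∧
    prob ρ {(_, _, xs, xs', _, _, _, _, ys, ys') : TamperedBasis t n N' M' |
      xs = xs' ∧ ys = ys'} = 1 ∧
    ∀ i : Fin t,
      prob ρ {(_, _, _, _, _, _, y, _, ys, _) : TamperedBasis t n N' M' | y ≠ ys i} = 1 ∨
      prob ρ {(x, _, xs, _, _, _, _, _, _, _) : TamperedBasis t n N' M' | x ≠ xs i} = 1

/-- Pure extension of `ρ` by registers holding `S = ext (X, Y)` and `S^[t] = (ext (X^i, Y^i))_i`, each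
with a copy; the arguments are `S`, its copy, `S^[t]`, its copy, and the registers of `ρ`. -/
def withOutputs (ext : Bits n × Bits n → Bits m) (ρ : TamperedBasis t n N' M' → ℂ) :
    Bits m → Bits m → (Fin t → Bits m) → (Fin t → Bits m) → TamperedBasis t n N' M' → ℂ :=
  fun s s' ss ss' (x, x', xs, xs', a, c, y, y', ys, ys') =>
    if s = ext (x, y) ∧ s' = ext (x, y) ∧
        (ss = fun i => ext (xs i, ys i)) ∧ (ss' = fun i => ext (xs i, ys i)) then
      ρ (x, x', xs, xs', a, c, y, y', ys, ys')
    else 0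

/-- The state of `S, (S^[t], X, X^[t], N')`. -/
def viewX (ext : Bits n × Bits n → Bits m) (ρ : TamperedBasis t n N' M' → ℂ) :
    Matrix (Bits m × (Fin t → Bits m) × Bits n × (Fin t → Bits n) × N')
      (Bits m × (Fin t → Bits m) × Bits n × (Fin t → Bits n) × N') ℂ :=
  marginal (B := Bits m × (Fin t → Bits m) × Bits n × (Fin t → Bits n) ×
      M' × Bits n × Bits n × (Fin t → Bits n) × (Fin t → Bits n))
    fun ((s, ss, x, xs, a), (s', ss', x', xs', c, y, y', ys, ys')) =>
      withOutputs ext ρ s s' ss ss' (x, x', xs, xs', a, c, y, y', ys, ys')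

/-- The state of `S, (S^[t], Y, Y^[t], M')`. -/
def viewY (ext : Bits n × Bits n → Bits m) (ρ : TamperedBasis t n N' M' → ℂ) :
    Matrix (Bits m × (Fin t → Bits m) × Bits n × (Fin t → Bits n) × M')
      (Bits m × (Fin t → Bits m) × Bits n × (Fin t → Bits n) × M') ℂ :=
  marginal (B := Bits m × (Fin t → Bits m) × Bits n × Bits n × (Fin t → Bits n) ×
      (Fin t → Bits n) × N' × Bits n × (Fin t → Bits n))
    fun ((s, ss, y, ys, c), (s', ss', x, x', xs, xs', a, y', ys')) =>
      withOutputs ext ρ s s' ss ss' (x, x', xs, xs', a, c, y, y', ys, ys')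

/-- `(t;k₁,k₂,ε)`-quantum secure 2-source `t`-non-malleable extractor. -/
def IsQuantumSecureNMExt (t : ℕ) (k₁ k₂ ε : ℝ) (ext : Bits n × Bits n → Bits m) : Prop :=
  ∀ (N' M' : Type) [Fintype N'] [Fintype M'] [DecidableEq N'] [DecidableEq M']
    (ρ : TamperedBasis t n N' M' → ℂ), IsQNMState k₁ k₂ ρ →
    traceNorm (viewX ext ρ - classicalState (uniform m) ⊗ₖ traceFst (viewX ext ρ)) ≤ ε ∧
    traceNorm (viewY ext ρ - classicalState (uniform m) ⊗ₖ traceFst (viewY ext ρ)) ≤ ε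

end Extractor

/-! ### One-many non-malleable codes in the split-state model

The set `{0,1}^m ∪ {same}` is `Option (Bits m)`, with `none` for `same`; a randomized function is a
function into probability distributions. -/

section Code

variable {n m t : ℕ} {N M N' M' : Type} [Fintype N] [Fintype M] [Fintype N'] [Fintype M']
  [DecidableEq N] [DecidableEq M] [DecidableEq N'] [DecidableEq M']

/-- Standard encoding and decoding scheme: `Pr (Dec (Enc s) = s) = 1` for all messages `s`. -/
def IsStandardScheme (Enc : Bits m → PMF (Bits n × Bits n))
    (Dec : Bits n × Bits n → Option (Bits m)) : Prop :=
  ∀ s, (Enc s).map Dec (some s) = 1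

/-- `copy(x, s)` is `s` if `x = same`, and `x` otherwise; here componentwise on `t`-tuples. -/
def copyTuple (d : Fin t → Option (Bits m)) (s : Bits m) : Fin t → Option (Bits m) :=
  fun i => some ((d i).getD s)

/-- The state `σ_{SXY}` with `S` uniform and `(X, Y) = Enc S`. -/
def encodedState (Enc : Bits m → PMF (Bits n × Bits n)) :
    Matrix (Bits m × Bits n × Bits n) (Bits m × Bits n × Bits n) ℂ :=
  classicalState ((uniform m).bind fun s => (Enc s).map fun c => (s, c))

/-- The operator `U ⊗ V` of the adversary, with the identity on the message register `S`. -/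
def adversaryOp (U : Matrix ((Fin t → Bits n) × N') (Bits n × N) ℂ)
    (V : Matrix ((Fin t → Bits n) × M') (Bits n × M) ℂ) :
    Matrix (Bits m × ((Fin t → Bits n) × N') × ((Fin t → Bits n) × M'))
      ((Bits m × Bits n × Bits n) × (N × M)) ℂ :=
  Matrix.of fun (s', u, v) ((s, x, y), (a, c)) => if s' = s then U u (x, a) * V v (y, c) else 0

/-- The state `(U ⊗ V)(σ ⊗ |ψ⟩⟨ψ|)(U ⊗ V)†` on the registers `S, (X^[t], N'), (Y^[t], M')`. -/
def tamperedState (Enc : Bits m → PMF (Bits n × Bits n))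
    (U : Matrix ((Fin t → Bits n) × N') (Bits n × N) ℂ)
    (V : Matrix ((Fin t → Bits n) × M') (Bits n × M) ℂ) (ψ : N × M → ℂ) :
    Matrix (Bits m × ((Fin t → Bits n) × N') × ((Fin t → Bits n) × M'))
      (Bits m × ((Fin t → Bits n) × N') × ((Fin t → Bits n) × M')) ℂ :=
  adversaryOp (m := m) U V * (encodedState Enc ⊗ₖ Matrix.vecMulVec ψ (star ψ)) * (adversaryOp (m := m) U V)ᴴ

/-- The state of `S, Dec(X^1,Y^1), …, Dec(X^t,Y^t)` after `X^[t]` and `Y^[t]` are measured in the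
computational basis, each pair `(X^i, Y^i)` is decoded, and all other registers are traced out. -/
def decodedState (Dec : Bits n × Bits n → Option (Bits m))
    (ρ : Matrix (Bits m × ((Fin t → Bits n) × N') × ((Fin t → Bits n) × M'))
      (Bits m × ((Fin t → Bits n) × N') × ((Fin t → Bits n) × M')) ℂ) :
    Matrix (Bits m × (Fin t → Option (Bits m))) (Bits m × (Fin t → Option (Bits m))) ℂ :=
  Matrix.of fun (s, w) (s', w') => ∑ xs : Fin t → Bits n, ∑ ys : Fin t → Bits n, ∑ a, ∑ c,
    if (fun i => Dec (xs i, ys i)) = w ∧ (fun i => Dec (xs i, ys i)) = w' then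
      ρ (s, (xs, a), (ys, c)) (s', (xs, a), (ys, c))
    else 0

/-- The distribution of `Z copy^(t)(D, Z)` for `Z` uniform and independent of `D`, as a state. -/
def simulatedState (D : PMF (Fin t → Option (Bits m))) :
    Matrix (Bits m × (Fin t → Option (Bits m))) (Bits m × (Fin t → Option (Bits m))) ℂ :=
  classicalState ((uniform m).bind fun z => D.map fun d => (z, copyTuple d z))

/-- `(Enc, Dec)` is a `(t;m,n,ε)`-quantum secure one-many non-malleable code in the split-state model:
it is a standard scheme, and for every adversary `(U, V, ψ)`, with arbitrary finite-dimensional registers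
`N, M, N', M'`, there is a simulating distribution on `({0,1}^m ∪ {same})^t`. -/
def IsQuantumSecureNMCode (t : ℕ) (ε : ℝ) (Enc : Bits m → PMF (Bits n × Bits n))
    (Dec : Bits n × Bits n → Option (Bits m)) : Prop :=
  IsStandardScheme Enc Dec ∧
  ∀ (N M N' M' : Type) [Fintype N] [Fintype M] [Fintype N'] [Fintype M']
    [DecidableEq N] [DecidableEq M] [DecidableEq N'] [DecidableEq M']
    (U : Matrix ((Fin t → Bits n) × N') (Bits n × N) ℂ)
    (V : Matrix ((Fin t → Bits n) × M') (Bits n × M) ℂ) (ψ : N × M → ℂ),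
    IsIsometry U → IsIsometry V → IsPureState ψ →
    ∃ D : PMF (Fin t → Option (Bits m)),
      traceNorm (decodedState Dec (tamperedState Enc U V ψ) - simulatedState D) ≤ ε

/-- The encoder built from `ext`: a uniformly random element of `ext⁻¹(s)`. -/
def preimageEnc (ext : Bits n × Bits n → Bits m) (h : Function.Surjective ext) (s : Bits m) :
    PMF (Bits n × Bits n) :=
  PMF.uniformOfFinset (Finset.univ.filter fun c => ext c = s)
    ((h s).imp fun _ hc => Finset.mem_filter.2 ⟨Finset.mem_univ _, hc⟩)

/-- The decoder built from `ext`: `Dec(x, y) = ext(x, y)`. -/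
def extDec (ext : Bits n × Bits n → Bits m) (c : Bits n × Bits n) : Option (Bits m) := some (ext c)

end Code

end SplitState

end

/-! Feed the adversary a uniform pair `(X, Y)` instead of an encoding and measure everything; let
`μ` be the resulting law (`tamperWeight`) and `ν` (`codeWeight`) the law for the encoding of a
uniform message. On each fibre of `ext` the two are proportional, so their ℓ¹ distance is that of
`ext (X, Y)` from uniform, which one use of the extractor bounds by `ε`
(`sum_abs_fiberCard_sub_le`).

Under `μ`, each index `i` falls into one of three cases: `X ≠ X^i`; `X = X^i` and `Y ≠ Y^i`; both
equal. Each of the resulting `3 ^ t` classes is the conjunction of a condition on the `X` side and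
one on the `Y` side (`tamperClass_eq_iff`), so conditioning on it is a pair of local contractions.
If the class has weight `p ≥ 2 ^ (-k)`, this costs at most `k` bits of min-entropy
(`le_condMinEntropy_of_contraction`). Within a class every index either has no fixed point on a
known side or decodes to the message itself. An index of the second kind is masked as `same`, so its
tampered word may be redirected to the complement of `X`. The extractor then makes the message
uniform and independent of the other outputs, up to `ε * p` (`sum_abs_output_le`,
`sum_abs_class_le`). The simulator samples from `μ` and outputs the decodings, with `same` at
untouched indices.

A class lighter than `2 ^ (-k)` costs at most `2 * 2 ^ (-k)`. If some class is heavy, at most `3 ^ t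
- 1` are light, and `2 * (3 ^ t - 1) ≤ 2 ^ (2 * t)`. If none is heavy, the simulator that always
answers `same` works: only the `3 ^ t - 1` other classes contribute to its error, apart from the
exchange of `ν` and `μ`. -/

noncomputable section

namespace SplitState

/-! ### Trace norm of Hermitian matrices -/

section TraceNorm

variable {ι : Type} [Fintype ι] [DecidableEq ι]

open Polynomial in
-- Only the multiset of eigenvalues matters, and it is the root multiset of the characteristic
-- polynomial.
lemma traceNorm_eq_sum_sqrt_of_charpoly {M : Matrix ι ι ℂ} {d : ι → ℝ}
    (h : (Mᴴ * M).charpoly = ∏ i, (X - C (d i : ℂ))) : traceNorm M = ∑ i, √(d i) := by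
  -- `traceNorm` is defined with the classical instance; the ambient one is identified with it.
  obtain rfl : ‹DecidableEq ι› = fun a b => Classical.propDecidable (a = b) :=
    Subsingleton.elim _ _
  classical
  have hM := Matrix.isHermitian_conjTranspose_mul_self M
  have hroots := hM.roots_charpoly_eq_eigenvalues
  rw [h, Polynomial.roots_prod _ _
    (by simp [Finset.prod_ne_zero_iff, Polynomial.X_sub_C_ne_zero])] at hroots
  have hmap : (Finset.univ.val.map d).map (fun r : ℝ => (r : ℂ)) =
      (Finset.univ.val.map hM.eigenvalues).map (fun r : ℝ => (r : ℂ)) := by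
    simpa [Multiset.map_map, Function.comp_def] using hroots
  have hd := Multiset.map_injective Complex.ofReal_injective hmap
  have hsum := congrArg (fun s => (Multiset.map Real.sqrt s).sum) hd
  simp only [Multiset.map_map] at hsum
  exact hsum.symm

lemma traceNorm_eq_sum_abs_of_diagonalized {M : Matrix ι ι ℂ} {d : ι → ℝ}
    (W : Matrix.unitaryGroup ι ℂ)
    (h : M = (W : Matrix ι ι ℂ) * Matrix.diagonal (fun i => (d i : ℂ)) * star (W : Matrix ι ι ℂ)) :
    traceNorm M = ∑ i, |d i| := by
  have hW : star (W : Matrix ι ι ℂ) * (W : Matrix ι ι ℂ) = 1 := Unitary.coe_star_mul_self W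
  have hstar : (Matrix.diagonal (fun i => (d i : ℂ)))ᴴ = Matrix.diagonal (fun i => (d i : ℂ)) := by
    rw [Matrix.diagonal_conjTranspose]
    congr 1
    ext i
    simp
  have hsq : Mᴴ * M = (W : Matrix ι ι ℂ) *
      (Matrix.diagonal (fun i => ((d i ^ 2 : ℝ) : ℂ)) * star (W : Matrix ι ι ℂ)) := by
    have hM : Mᴴ = M := by
      rw [h, Matrix.conjTranspose_mul, Matrix.conjTranspose_mul, hstar,
        Matrix.star_eq_conjTranspose, Matrix.conjTranspose_conjTranspose, Matrix.mul_assoc]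
    rw [hM, h]
    calc _ = (W : Matrix ι ι ℂ) * (Matrix.diagonal (fun i => (d i : ℂ)) *
          (star (W : Matrix ι ι ℂ) * (W : Matrix ι ι ℂ)) *
          Matrix.diagonal (fun i => (d i : ℂ)) * star (W : Matrix ι ι ℂ)) := by
            simp only [Matrix.mul_assoc]
      _ = _ := by
            rw [hW, Matrix.mul_one, Matrix.diagonal_mul_diagonal]
            simp [pow_two]
  rw [traceNorm_eq_sum_sqrt_of_charpoly (d := fun i => d i ^ 2)]
  · simp [Real.sqrt_sq_eq_abs]
  · rw [hsq, Matrix.charpoly_mul_comm, Matrix.mul_assoc, hW, Matrix.mul_one,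
      Matrix.charpoly_diagonal]

lemma traceNorm_diagonal (d : ι → ℝ) :
    traceNorm (Matrix.diagonal fun i => (d i : ℂ)) = ∑ i, |d i| :=
  traceNorm_eq_sum_abs_of_diagonalized 1 (by simp)

/-- In an eigenbasis, `M i i` is the sum of the eigenvalues weighted by `‖W i j‖ ^ 2`, and the
columns of `W` are unit vectors. This turns trace-norm bounds into bounds on measured distributions.
-/
lemma sum_norm_diag_le_traceNorm {M : Matrix ι ι ℂ} (hM : M.IsHermitian) :
    ∑ i, ‖M i i‖ ≤ traceNorm M := by
  set W : Matrix ι ι ℂ := (hM.eigenvectorUnitary : Matrix ι ι ℂ) with hWdef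
  have hspec : M = W * Matrix.diagonal (fun i => (hM.eigenvalues i : ℂ)) * star W := by
    have := hM.spectral_theorem
    rwa [Unitary.conjStarAlgAut_apply] at this
  rw [traceNorm_eq_sum_abs_of_diagonalized _ hspec]
  have hcol : ∀ j, ∑ i, ‖W i j‖ ^ 2 = 1 := by
    intro j
    have h1 : star W * W = 1 := Unitary.coe_star_mul_self hM.eigenvectorUnitary
    have h2 := congrFun (congrFun h1 j) j
    rw [Matrix.mul_apply, Matrix.one_apply_eq] at h2
    have h3 : ∀ i, star W j i * W i j = ((‖W i j‖ ^ 2 : ℝ) : ℂ) := by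
      intro i
      rw [Matrix.star_apply, RCLike.star_def, RCLike.conj_mul]
      norm_cast
    simp_rw [h3] at h2
    exact_mod_cast h2
  have hentry : ∀ i, ‖M i i‖ ≤ ∑ j, |hM.eigenvalues j| * ‖W i j‖ ^ 2 := by
    intro i
    conv_lhs => rw [hspec]
    rw [Matrix.mul_apply]
    refine (norm_sum_le _ _).trans (Finset.sum_le_sum fun j _ => ?_)
    rw [Matrix.mul_diagonal, Matrix.star_apply, norm_mul, norm_mul, norm_star, Complex.norm_real,
      Real.norm_eq_abs]
    exact le_of_eq (by ring)
  calc ∑ i, ‖M i i‖ ≤ ∑ i, ∑ j, |hM.eigenvalues j| * ‖W i j‖ ^ 2 :=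
        Finset.sum_le_sum fun i _ => hentry i
    _ = ∑ j, |hM.eigenvalues j| := by
        rw [Finset.sum_comm]
        simp_rw [← Finset.mul_sum, hcol, mul_one]

end TraceNorm

/-! ### Finite distributions and ℓ¹ sums -/

section FiniteSums

/-- Coarse-graining does not increase the `ℓ¹` norm. -/
lemma sum_abs_fiber_le {Ω K : Type} [Fintype Ω] [Fintype K] [DecidableEq K] (f : Ω → K)
    (μ : Ω → ℝ) : ∑ k, |∑ w, if f w = k then μ w else 0| ≤ ∑ w, |μ w| := by
  calc ∑ k, |∑ w, if f w = k then μ w else 0|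
      ≤ ∑ k, ∑ w, if f w = k then |μ w| else 0 := by
        refine Finset.sum_le_sum fun k _ => (Finset.abs_sum_le_sum_abs _ _).trans (le_of_eq ?_)
        exact Finset.sum_congr rfl fun w _ => by split_ifs <;> simp
    _ = ∑ w, |μ w| := by
        rw [Finset.sum_comm]
        simp

lemma toReal_bind_apply {α β : Type} [Fintype α] (p : PMF α) (f : α → PMF β) (b : β) :
    ((p.bind f) b).toReal = ∑ a, (p a).toReal * (f a b).toReal := by
  rw [PMF.bind_apply, tsum_fintype, ENNReal.toReal_sum]
  · simp
  · exact fun a _ => ENNReal.mul_ne_top (p.apply_ne_top a) ((f a).apply_ne_top b)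

lemma toReal_map_apply {α β : Type} [Fintype α] [DecidableEq β] (p : PMF α) (f : α → β) (b : β) :
    ((p.map f) b).toReal = ∑ a, if f a = b then (p a).toReal else 0 := by
  rw [PMF.map_apply, tsum_fintype, ENNReal.toReal_sum]
  · refine Finset.sum_congr rfl fun a _ => ?_
    by_cases h : f a = b
    · simp [h]
    · simp [h, Ne.symm h]
  · intro a _
    split_ifs
    · exact p.apply_ne_top a
    · simp

lemma toReal_ofFintype_apply {α : Type} [Fintype α] {q : α → ℝ} (hq : ∀ a, 0 ≤ q a)
    (h : ∑ a, ENNReal.ofReal (q a) = 1) (a : α) :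
    ((PMF.ofFintype (fun a => ENNReal.ofReal (q a)) h) a).toReal = q a := by
  rw [PMF.ofFintype_apply, ENNReal.toReal_ofReal (hq a)]

end FiniteSums

/-! ### Marginals of vectors and the operator order -/

section Marginal

variable {A B C E : Type} [Fintype B] [Fintype C] [Fintype E]

lemma isHermitian_marginal (G : A × B → ℂ) : (marginal G).IsHermitian := by
  ext a a'
  simp [marginal, Matrix.conjTranspose_apply, mul_comm]

lemma marginal_apply_self (G : A × B → ℂ) (a : A) :
    marginal G a a = ((∑ b, ‖G (a, b)‖ ^ 2 : ℝ) : ℂ) := by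
  simp only [marginal, Matrix.of_apply, RCLike.star_def, RCLike.mul_conj]
  norm_cast

variable [Fintype A]

lemma dotProduct_marginal_mulVec (G : A × B → ℂ) (v : A → ℂ) :
    star v ⬝ᵥ (marginal G *ᵥ v) = ((∑ b, ‖∑ a, star (v a) * G (a, b)‖ ^ 2 : ℝ) : ℂ) := by
  have h : ∀ b, ((‖∑ a, star (v a) * G (a, b)‖ ^ 2 : ℝ) : ℂ) =
      (∑ a, star (v a) * G (a, b)) * ∑ a, v a * star (G (a, b)) := by
    intro b
    have h1 : (∑ a, v a * star (G (a, b))) = star (∑ a, star (v a) * G (a, b)) := by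
      simp [star_sum, mul_comm]
    rw [h1, RCLike.star_def, RCLike.mul_conj]
    norm_cast
  rw [Complex.ofReal_sum]
  simp only [h, Finset.sum_mul_sum]
  simp only [dotProduct, Matrix.mulVec, marginal, Matrix.of_apply, Pi.star_apply, Finset.mul_sum,
    Finset.sum_mul]
  conv_rhs => rw [Finset.sum_comm]
  refine Finset.sum_congr rfl fun a _ => ?_
  rw [Finset.sum_comm]
  exact Finset.sum_congr rfl fun b _ => Finset.sum_congr rfl fun a' _ => by ring

lemma posSemidef_marginal_sub {G : A × B → ℂ} {H : A × C → ℂ}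
    (h : ∀ v : A → ℂ, ∑ b, ‖∑ a, v a * G (a, b)‖ ^ 2 ≤ ∑ c, ‖∑ a, v a * H (a, c)‖ ^ 2) :
    (marginal H - marginal G).PosSemidef := by
  refine Matrix.PosSemidef.of_dotProduct_mulVec_nonneg
    ((isHermitian_marginal H).sub (isHermitian_marginal G)) fun v => ?_
  rw [Matrix.sub_mulVec, dotProduct_sub, dotProduct_marginal_mulVec, dotProduct_marginal_mulVec,
    ← Complex.ofReal_sub]
  exact_mod_cast sub_nonneg.2 (h (star v))

lemma posSemidef_marginal (G : A × B → ℂ) : (marginal G).PosSemidef := by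
  refine Matrix.PosSemidef.of_dotProduct_mulVec_nonneg (isHermitian_marginal G) fun v => ?_
  rw [dotProduct_marginal_mulVec]
  exact_mod_cast Finset.sum_nonneg fun b _ => by positivity

lemma trace_marginal (G : A × B → ℂ) :
    (marginal G).trace = ((∑ p, ‖G p‖ ^ 2 : ℝ) : ℂ) := by
  simp_rw [Matrix.trace, Matrix.diag_apply, marginal_apply_self]
  rw [← Complex.ofReal_sum, Fintype.sum_prod_type]

/-- A real `sInf` is `0` on a set unbounded below, so bounding it by a member needs this. Taking
traces in the operator inequality gives `1 ≤ 2 ^ l * card A`. -/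
lemma bddBelow_maxDivergence [DecidableEq A] {ρ : Matrix (A × E) (A × E) ℂ}
    (hρ : ρ.trace = 1) :
    BddBelow {l : ℝ | ∃ τ : Matrix E E ℂ, IsState τ ∧
      ((((2 : ℝ) ^ l : ℝ) : ℂ) • ((1 : Matrix A A ℂ) ⊗ₖ τ) - ρ).PosSemidef} := by
  refine ⟨Real.logb 2 (1 / Fintype.card A), ?_⟩
  rintro l ⟨τ, hτ, hl⟩
  have h := hl.trace_nonneg
  rw [Matrix.trace_sub, Matrix.trace_smul, Matrix.trace_kronecker, hτ.2, hρ, Matrix.trace_one,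
    smul_eq_mul, mul_one] at h
  have h' : 0 ≤ (2 : ℝ) ^ l * Fintype.card A - 1 := by exact_mod_cast h
  have hcard : (0 : ℝ) < Fintype.card A := by
    rcases Nat.eq_zero_or_pos (Fintype.card A) with h0 | h0
    · rw [h0] at h'
      norm_num at h'
    · exact_mod_cast h0
  rw [Real.logb_le_iff_le_rpow one_lt_two (by positivity), div_le_iff₀ hcard]
  linarith

end Marginal

/-- Euclidean operator norm at most one. -/
def IsContraction {A B : Type} [Fintype A] [Fintype B] (K : Matrix B A ℂ) : Prop :=
  ∀ v : A → ℂ, ∑ b, ‖∑ a, K b a * v a‖ ^ 2 ≤ ∑ a, ‖v a‖ ^ 2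

/-! ### Min-entropy after local filtering -/

section MinEntropy

variable {n : ℕ} {N N₀ M : Type} [Fintype N] [Fintype N₀] [Fintype M]

/-- The contraction `K x` acts on a register that is traced out, so removing it can only enlarge the
marginal. What remains does not depend on `x`, and the traced-out copy of `X` makes it diagonal in
`x`; hence it is `1 ⊗ τ` with `τ` of trace the total weight of `φ`. -/
lemma le_condMinEntropy_of_contraction {k₁ : ℝ} {f : Bits n → Bits n → N → M → ℂ}
    {K : Bits n → Matrix N N₀ ℂ} (hK : ∀ x, IsContraction (K x)) {φ : Bits n → N₀ → M → ℂ}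
    (hf : ∀ x y a c, f x y a c = ∑ a₀, K x a a₀ * φ y a₀ c)
    (hone : ∑ x, ∑ y, ∑ a, ∑ c, ‖f x y a c‖ ^ 2 = 1)
    (hφ : ∑ y, ∑ a₀, ∑ c, ‖φ y a₀ c‖ ^ 2 ≤ (2 : ℝ) ^ (-k₁)) :
    k₁ ≤ condMinEntropy (A := Bits n) (E := M × Bits n × Bits n)
      (marginal (B := Bits n × N) fun ((x, c, y, y'), (x', a)) =>
        if x = x' ∧ y = y' then f x y a c else 0) := by
  set G : (Bits n × M × Bits n × Bits n) × (Bits n × N) → ℂ :=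
    fun ((x, c, y, y'), (x', a)) => if x = x' ∧ y = y' then f x y a c else 0 with hG
  -- `F` is the unnormalized vector on the conditioning side; `H` is `G` with the contractions
  -- removed.
  set F : (M × Bits n × Bits n) × N₀ → ℂ :=
    fun ((c, y, y'), a₀) => if y = y' then φ y a₀ c else 0 with hF
  set H : (Bits n × M × Bits n × Bits n) × (Bits n × N₀) → ℂ :=
    fun ((x, e), (x', a₀)) => if x = x' then F (e, a₀) else 0 with hH
  set Q : ℝ := ∑ y, ∑ a₀, ∑ c, ‖φ y a₀ c‖ ^ 2 with hQ
  have hdom : (marginal H - marginal G).PosSemidef := by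
    refine posSemidef_marginal_sub fun v => ?_
    rw [Fintype.sum_prod_type, Fintype.sum_prod_type]
    refine Finset.sum_le_sum fun x' _ => ?_
    have hw : ∀ a₀, ∑ p, v p * H (p, (x', a₀)) = ∑ e, v (x', e) * F (e, a₀) := by
      intro a₀
      rw [Fintype.sum_prod_type, Finset.sum_eq_single x']
      · simp [hH]
      · intro x _ hx
        simp [hH, hx]
      · simp
    have hw' : ∀ a, ∑ p, v p * G (p, (x', a)) =
        ∑ a₀, K x' a a₀ * ∑ e, v (x', e) * F (e, a₀) := by
      intro a
      rw [Fintype.sum_prod_type, Finset.sum_eq_single x']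
      · simp_rw [Finset.mul_sum]
        rw [Finset.sum_comm]
        refine Finset.sum_congr rfl ?_
        rintro ⟨c, y, y'⟩ _
        by_cases hy : y = y'
        · simp only [hG, hF, hy, and_self, if_true, hf, Finset.mul_sum]
          exact Finset.sum_congr rfl fun a₀ _ => by ring
        · simp [hG, hF, hy]
      · intro x _ hx
        refine Finset.sum_eq_zero ?_
        rintro ⟨c, y, y'⟩ _
        simp [hG, hx]
      · simp
    simp_rw [hw, hw']
    exact hK x' _
  have htraceF : (marginal F).trace = (Q : ℂ) := by
    rw [trace_marginal]
    congr 1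
    simp_rw [Fintype.sum_prod_type]
    have : ∀ (c : M) (y y' : Bits n) (a₀ : N₀), ‖F ((c, y, y'), a₀)‖ ^ 2 =
        if y = y' then ‖φ y a₀ c‖ ^ 2 else 0 := by
      intro c y y' a₀
      by_cases hy : y = y' <;> simp [hF, hy]
    simp_rw [this]
    have hcol : ∀ (c : M) (y : Bits n), ∑ y', ∑ a₀, (if y = y' then ‖φ y a₀ c‖ ^ 2 else 0) =
        ∑ a₀, ‖φ y a₀ c‖ ^ 2 := by
      intro c y
      rw [Finset.sum_comm]
      simp
    simp_rw [hcol]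
    rw [Finset.sum_comm, hQ]
    exact Finset.sum_congr rfl fun y _ => Finset.sum_comm
  have htraceG : (marginal G).trace = 1 := by
    rw [trace_marginal, ← Complex.ofReal_one, ← hone]
    congr 1
    simp_rw [Fintype.sum_prod_type]
    have : ∀ (x x' y y' : Bits n) (c : M) (a : N), ‖G ((x, c, y, y'), (x', a))‖ ^ 2 =
        if x = x' then (if y = y' then ‖f x y a c‖ ^ 2 else 0) else 0 := by
      intro x x' y y' c a
      by_cases hx : x = x' <;> by_cases hy : y = y' <;> simp [hG, hx, hy]
    simp_rw [this]
    refine Finset.sum_congr rfl fun x _ => ?_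
    have hcol : ∀ (c : M) (y : Bits n), ∑ y', ∑ x', ∑ a,
        (if x = x' then (if y = y' then ‖f x y a c‖ ^ 2 else 0) else 0) =
        ∑ a, ‖f x y a c‖ ^ 2 := by
      intro c y
      rw [Finset.sum_eq_single y (by intro y' _ hy'; simp [Ne.symm hy']) (by simp),
        Finset.sum_eq_single x (by intro x' _ hx'; simp [Ne.symm hx']) (by simp)]
      simp
    simp_rw [hcol]
    rw [Finset.sum_comm]
    exact Finset.sum_congr rfl fun y _ => Finset.sum_comm
  have hkron : (1 : Matrix (Bits n) (Bits n) ℂ) ⊗ₖ marginal F = marginal H := by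
    ext ⟨x, e⟩ ⟨x₂, e₂⟩
    rw [Matrix.kronecker_apply, Matrix.one_apply]
    simp only [marginal, Matrix.of_apply, Fintype.sum_prod_type]
    rw [Finset.sum_eq_single x]
    · by_cases hx : x = x₂
      · simp [hH, hx]
      · simp [hH, hx, Ne.symm hx]
    · intro x' _ hx'
      simp [hH, Ne.symm hx']
    · simp
  -- Dominating an operator of trace one forces a positive trace, so `marginal F` can be normalized.
  have hQpos : 0 < Q := by
    have h := hdom.trace_nonneg
    rw [Matrix.trace_sub, ← hkron, Matrix.trace_kronecker, htraceF, htraceG,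
      Matrix.trace_one] at h
    have h' : 0 ≤ (Fintype.card (Bits n) : ℝ) * Q - 1 := by exact_mod_cast h
    by_contra hneg
    have : (Fintype.card (Bits n) : ℝ) * Q ≤ 0 :=
      mul_nonpos_of_nonneg_of_nonpos (Nat.cast_nonneg _) (not_lt.1 hneg)
    linarith
  have hmem : Real.logb 2 Q ∈ {l : ℝ | ∃ τ : Matrix (M × Bits n × Bits n) (M × Bits n × Bits n) ℂ,
      IsState τ ∧ ((((2 : ℝ) ^ l : ℝ) : ℂ) •
        ((1 : Matrix (Bits n) (Bits n) ℂ) ⊗ₖ τ) - marginal G).PosSemidef} := by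
    have hQ0 : (Q : ℂ) ≠ 0 := by exact_mod_cast hQpos.ne'
    refine ⟨(Q : ℂ)⁻¹ • marginal F, ⟨?_, ?_⟩, ?_⟩
    · refine (posSemidef_marginal F).smul ?_
      rw [← Complex.ofReal_inv]
      exact_mod_cast (inv_pos.2 hQpos).le
    · rw [Matrix.trace_smul, htraceF, smul_eq_mul, inv_mul_cancel₀ hQ0]
    · rw [Real.rpow_logb two_pos (by norm_num) hQpos, Matrix.kronecker_smul, smul_smul,
        mul_inv_cancel₀ hQ0, one_smul, hkron]
      exact hdom
  have hle := csInf_le (bddBelow_maxDivergence htraceG) hmem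
  have hlog : Real.logb 2 Q ≤ -k₁ := (Real.logb_le_iff_le_rpow one_lt_two hQpos).2 hφ
  unfold condMinEntropy
  linarith

end MinEntropy

/-! ### Isometries given by injections of basis vectors -/

section BasisMap

variable {A B : Type} [Fintype A] [Fintype B] [DecidableEq A] [DecidableEq B]

/-- The operator that maps the basis vector `a` to the basis vector `j a`. -/
def basisMap (j : A → B) : Matrix B A ℂ := Matrix.of fun b a => if b = j a then 1 else 0

omit [Fintype A] in
lemma isIsometry_basisMap {j : A → B} (hj : Function.Injective j) : IsIsometry (basisMap j) := by
  ext a a'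
  rw [Matrix.mul_apply, Matrix.one_apply]
  simp [basisMap, Matrix.conjTranspose_apply, hj.eq_iff, eq_comm]

end BasisMap

lemma isContraction_one {A : Type} [Fintype A] [DecidableEq A] :
    IsContraction (1 : Matrix A A ℂ) := by
  intro v
  simp [Matrix.one_apply]

lemma IsContraction.sum_sum_norm_sq_le {A B C : Type} [Fintype A] [Fintype B] [Fintype C]
    {K : Matrix B A ℂ} (hK : IsContraction K) (ψ : C → A → ℂ) :
    ∑ c, ∑ b, ‖∑ a, K b a * ψ c a‖ ^ 2 ≤ ∑ c, ∑ a, ‖ψ c a‖ ^ 2 :=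
  Finset.sum_le_sum fun c _ => hK (ψ c)

lemma prob_eq_one {ι : Type} [Fintype ι] {ψ : ι → ℂ} {S : Set ι} (hψ : IsPureState ψ)
    (h : ∀ i, ψ i ≠ 0 → i ∈ S) : prob ψ S = 1 := by
  rw [← hψ]
  refine Finset.sum_congr rfl fun i _ => ?_
  by_cases hi : ψ i = 0
  · simp [hi, Set.indicator]
  · rw [Set.indicator_of_mem (h i hi)]

/-- A sum over a type reduces to the range of an injection that carries the whole sum. -/
lemma sum_comp_injective {α β R : Type} [Fintype α] [Fintype β] [AddCommMonoid R] {e : α → β}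
    (he : Function.Injective e) {F : β → R} (hF : ∀ b, (∀ a, e a ≠ b) → F b = 0) :
    ∑ b, F b = ∑ a, F (e a) := by
  refine (Finset.sum_of_injOn e he.injOn (by simp [Set.MapsTo]) ?_ (fun _ _ => rfl)).symm
  intro b _ hb
  exact hF b fun a ha => hb ⟨a, by simp, ha⟩

/-! ### Construction of qma- and qnm-states from amplitudes -/

section Copied

variable {n t : ℕ} {N M : Type}

/-- The vector with amplitudes `f` in which `X` and `Y` have been copied. -/
def copied (f : Bits n × Bits n × N × M → ℂ) : Bits n × Bits n × N × M × Bits n × Bits n → ℂ :=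
  fun (x, x', a, c, y, y') => if x = x' ∧ y = y' then f (x, y, a, c) else 0

/-- The basis vector of `copied`. -/
def copyEmb (q : Bits n × Bits n × N × M) : Bits n × Bits n × N × M × Bits n × Bits n :=
  (q.1, q.1, q.2.2.1, q.2.2.2, q.2.1, q.2.1)

/-- The basis vector after `X^[t] = g (X, N)` and `Y^[t] = h (Y, M)` have been recorded, with copies. -/
def tamperEmb (g : Bits n → N → Fin t → Bits n) (h : Bits n → M → Fin t → Bits n)
    (q : Bits n × Bits n × N × M) : TamperedBasis t n N M :=
  (q.1, q.1, g q.1 q.2.2.1, g q.1 q.2.2.1, q.2.2.1, q.2.2.2, q.2.1, q.2.1,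
    h q.2.1 q.2.2.2, h q.2.1 q.2.2.2)

lemma copyEmb_injective : Function.Injective (copyEmb (n := n) (N := N) (M := M)) := by
  rintro ⟨x, y, a, c⟩ ⟨x₂, y₂, a₂, c₂⟩ h
  simp only [copyEmb, Prod.mk.injEq] at h ⊢
  tauto

lemma tamperEmb_injective (g : Bits n → N → Fin t → Bits n) (h : Bits n → M → Fin t → Bits n) :
    Function.Injective (tamperEmb g h) := by
  rintro ⟨x, y, a, c⟩ ⟨x₂, y₂, a₂, c₂⟩ hq
  simp only [tamperEmb, Prod.mk.injEq] at hq ⊢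
  tauto

lemma copied_copyEmb (f : Bits n × Bits n × N × M → ℂ) (q) : copied f (copyEmb q) = f q := by
  simp [copied, copyEmb]

lemma copied_eq_zero (f : Bits n × Bits n × N × M → ℂ) {b} (hb : ∀ q, copyEmb q ≠ b) :
    copied f b = 0 := by
  obtain ⟨x, x', a, c, y, y'⟩ := b
  simp only [copied]
  rw [if_neg]
  rintro ⟨rfl, rfl⟩
  exact hb (x, y, a, c) rfl

variable [DecidableEq N] [DecidableEq M]

/-- The safe isometry that records `g (X, N)` with a copy. -/
def recordOp (g : Bits n → N → Fin t → Bits n) :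
    Matrix (Bits n × (Fin t → Bits n) × (Fin t → Bits n) × N) (Bits n × N) ℂ :=
  basisMap fun p => (p.1, g p.1 p.2, g p.1 p.2, p.2)

variable [Fintype N] [Fintype M]

lemma isIsometry_recordOp (g : Bits n → N → Fin t → Bits n) : IsIsometry (recordOp g) := by
  refine isIsometry_basisMap ?_
  rintro ⟨x, a⟩ ⟨x', a'⟩ h
  simp only [Prod.mk.injEq] at h ⊢
  tauto

lemma isSafe_recordOp (g : Bits n → N → Fin t → Bits n) : IsSafe (recordOp g) := by
  refine ⟨fun x => basisMap fun a => (g x a, g x a, a), fun x => isIsometry_basisMap ?_, ?_⟩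
  · intro a a' h
    simp only [Prod.mk.injEq] at h
    tauto
  · rintro x' ⟨xs, xs', a'⟩ x a
    by_cases hx : x' = x
    · simp [recordOp, basisMap, hx]
    · simp [recordOp, basisMap, hx]

lemma tamper_recordOp (g : Bits n → N → Fin t → Bits n) (h : Bits n → M → Fin t → Bits n)
    (σ : Bits n × Bits n × N × M × Bits n × Bits n → ℂ) (x x' xs xs' a c y y' ys ys') :
    tamper (recordOp g) (recordOp h) σ (x, x', xs, xs', a, c, y, y', ys, ys') =
      if xs = g x a ∧ xs' = g x a ∧ ys = h y c ∧ ys' = h y c then σ (x, x', a, c, y, y') else 0 := by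
  simp only [tamper]
  rw [Finset.sum_eq_single x, Finset.sum_eq_single a, Finset.sum_eq_single y,
    Finset.sum_eq_single c]
  · simp only [recordOp, basisMap, Matrix.of_apply, Prod.mk.injEq, true_and, and_true]
    split_ifs <;> first | tauto | simp
  all_goals simp +contextual [recordOp, basisMap, eq_comm]

lemma tamper_copied_tamperEmb (g : Bits n → N → Fin t → Bits n) (h : Bits n → M → Fin t → Bits n)
    (f : Bits n × Bits n × N × M → ℂ) (q) :
    tamper (recordOp g) (recordOp h) (copied f) (tamperEmb g h q) = f q := by
  simp [tamperEmb, tamper_recordOp, copied]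

lemma tamper_copied_eq_zero (g : Bits n → N → Fin t → Bits n) (h : Bits n → M → Fin t → Bits n)
    (f : Bits n × Bits n × N × M → ℂ) {b} (hb : ∀ q, tamperEmb g h q ≠ b) :
    tamper (recordOp g) (recordOp h) (copied f) b = 0 := by
  obtain ⟨x, x', xs, xs', a, c, y, y', ys, ys'⟩ := b
  rw [tamper_recordOp]
  by_cases hc : xs = g x a ∧ xs' = g x a ∧ ys = h y c ∧ ys' = h y c
  · rw [if_pos hc]
    obtain ⟨rfl, rfl, rfl, rfl⟩ := hc
    simp only [copied]
    rw [if_neg]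
    rintro ⟨rfl, rfl⟩
    exact hb (x, y, a, c) rfl
  · rw [if_neg hc]

omit [DecidableEq N] [DecidableEq M] in
lemma isPureState_copied {f : Bits n × Bits n × N × M → ℂ} (hf : IsPureState f) :
    IsPureState (copied f) := by
  unfold IsPureState
  rw [sum_comp_injective copyEmb_injective fun b hb => by simp [copied_eq_zero f hb]]
  simp_rw [copied_copyEmb]
  exact hf

lemma isPureState_tamper_copied (g : Bits n → N → Fin t → Bits n)
    (h : Bits n → M → Fin t → Bits n) {f : Bits n × Bits n × N × M → ℂ} (hf : IsPureState f) :
    IsPureState (tamper (recordOp g) (recordOp h) (copied f)) := by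
  unfold IsPureState
  rw [sum_comp_injective (tamperEmb_injective g h) fun b hb => by
    simp [tamper_copied_eq_zero g h f hb]]
  simp_rw [tamper_copied_tamperEmb]
  exact hf

omit [DecidableEq N] [DecidableEq M] in
-- For each source, its own contractions drop out because their register is traced out, and those of
-- the other side only shrink the remaining vector. The factor `2 ^ n` counts the values of the
-- other source.
lemma isQMAState_copied {N₀ M₀ : Type} [Fintype N₀] [Fintype M₀] {k' : ℝ}
    {K : Bits n → Matrix N N₀ ℂ} {L : Bits n → Matrix M M₀ ℂ} (hK : ∀ x, IsContraction (K x))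
    (hL : ∀ y, IsContraction (L y)) {φ : N₀ → M₀ → ℂ} {f : Bits n × Bits n × N × M → ℂ}
    (hf : ∀ x y a c, f (x, y, a, c) = ∑ a₀, ∑ c₀, K x a a₀ * L y c c₀ * φ a₀ c₀)
    (hone : IsPureState f)
    (hφ : 2 ^ n * ∑ a₀, ∑ c₀, ‖φ a₀ c₀‖ ^ 2 ≤ (2 : ℝ) ^ (-k')) :
    IsQMAState k' k' (copied f) := by
  have hone' : ∑ x, ∑ y, ∑ a, ∑ c, ‖f (x, y, a, c)‖ ^ 2 = 1 := by
    rw [← hone]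
    simp_rw [Fintype.sum_prod_type]
  have hcard : (∑ _y : Bits n, ∑ a₀, ∑ c₀, ‖φ a₀ c₀‖ ^ 2) =
      2 ^ n * ∑ a₀, ∑ c₀, ‖φ a₀ c₀‖ ^ 2 := by
    simp
  refine ⟨isPureState_copied hone, prob_eq_one (isPureState_copied hone) ?_, ?_, ?_⟩
  · rintro ⟨x, x', a, c, y, y'⟩ hne
    by_contra hcon
    exact hne (if_neg hcon)
  · refine le_condMinEntropy_of_contraction (f := fun x y a c => f (x, y, a, c)) hK
      (φ := fun y a₀ c => ∑ c₀, L y c c₀ * φ a₀ c₀) ?_ hone' ?_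
    · intro x y a c
      rw [hf]
      refine Finset.sum_congr rfl fun a₀ _ => ?_
      rw [Finset.mul_sum]
      exact Finset.sum_congr rfl fun c₀ _ => by ring
    · refine le_trans ?_ (hcard.le.trans hφ)
      exact Finset.sum_le_sum fun y _ => (hL y).sum_sum_norm_sq_le φ
  -- The same argument with the two sides exchanged.
  · have := le_condMinEntropy_of_contraction (k₁ := k') (f := fun y x c a => f (x, y, a, c)) hL
      (φ := fun x c₀ a => ∑ a₀, K x a a₀ * φ a₀ c₀) ?_ ?_ ?_
    · convert this using 3
      ext ⟨⟨y, a, x, x'⟩, y', c⟩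
      simp only [copied, and_comm]
    · intro y x c a
      rw [hf, Finset.sum_comm]
      refine Finset.sum_congr rfl fun c₀ _ => ?_
      rw [Finset.mul_sum]
      exact Finset.sum_congr rfl fun a₀ _ => by ring
    · rw [Finset.sum_comm, ← hone']
      exact Finset.sum_congr rfl fun x _ => Finset.sum_congr rfl fun y _ => Finset.sum_comm
    · refine le_trans ?_ (hcard.le.trans hφ)
      refine Finset.sum_le_sum fun x _ => ?_
      rw [Finset.sum_comm (f := fun a₀ c₀ => ‖φ a₀ c₀‖ ^ 2)]
      exact (hK x).sum_sum_norm_sq_le fun c₀ a₀ => φ a₀ c₀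

lemma isQNMState_tamper_copied {k' : ℝ} {f : Bits n × Bits n × N × M → ℂ}
    (hqma : IsQMAState k' k' (copied f)) (hone : IsPureState f)
    {g : Bits n → N → Fin t → Bits n} {h : Bits n → M → Fin t → Bits n}
    (hfix : ∀ i, (∀ x y a c, f (x, y, a, c) ≠ 0 → y ≠ h y c i) ∨
      (∀ x y a c, f (x, y, a, c) ≠ 0 → x ≠ g x a i)) :
    IsQNMState k' k' (tamper (recordOp g) (recordOp h) (copied f)) := by
  have hsupp : ∀ b, tamper (recordOp g) (recordOp h) (copied f) b ≠ 0 →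
      ∃ q, f q ≠ 0 ∧ tamperEmb g h q = b := by
    intro b hb
    by_contra! hcon
    by_cases hq : ∃ q, tamperEmb g h q = b
    · obtain ⟨q, rfl⟩ := hq
      rw [tamper_copied_tamperEmb] at hb
      exact hcon q hb rfl
    · exact hb (tamper_copied_eq_zero g h f (not_exists.1 hq))
  have hpure := isPureState_tamper_copied g h hone
  refine ⟨N, M, inferInstance, inferInstance, inferInstance, inferInstance, copied f, recordOp g,
    recordOp h, hqma, isIsometry_recordOp g, isIsometry_recordOp h, isSafe_recordOp g,
    isSafe_recordOp h, rfl, prob_eq_one hpure ?_, fun i => ?_⟩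
  · intro b hb
    obtain ⟨⟨x, y, a, c⟩, -, rfl⟩ := hsupp b hb
    exact ⟨rfl, rfl⟩
  · refine (hfix i).imp (fun hi => ?_) (fun hi => ?_)
    · refine prob_eq_one hpure fun b hb => ?_
      obtain ⟨⟨x, y, a, c⟩, hq, rfl⟩ := hsupp b hb
      exact hi x y a c hq
    · refine prob_eq_one hpure fun b hb => ?_
      obtain ⟨⟨x, y, a, c⟩, hq, rfl⟩ := hsupp b hb
      exact hi x y a c hq

end Copied

/-! ### From the extractor's quantum view to classical output weights -/

section View

variable {n m t : ℕ} {N M : Type} [Fintype N] [Fintype M]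

/-- Total weight of `S = s`, `S^[t] = ss` in the diagonal of the view. -/
lemma sum_viewX_diag (ext : Bits n × Bits n → Bits m) (ρ : TamperedBasis t n N M → ℂ)
    (s : Bits m) (ss : Fin t → Bits m) :
    ∑ p : Bits n × (Fin t → Bits n) × N, viewX ext ρ (s, ss, p) (s, ss, p) =
      ((∑ b : TamperedBasis t n N M, if s = ext (b.1, b.2.2.2.2.2.2.1) ∧
        (ss = fun i => ext (b.2.2.1 i, b.2.2.2.2.2.2.2.2.1 i)) then ‖ρ b‖ ^ 2 else 0 : ℝ) : ℂ) := by
  unfold viewX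
  simp_rw [marginal_apply_self]
  rw [← Complex.ofReal_sum, ← Fintype.sum_prod_type']
  congr 1
  let e : TamperedBasis t n N M → (Bits n × (Fin t → Bits n) × N) × (Bits m × (Fin t → Bits m) ×
      Bits n × (Fin t → Bits n) × M × Bits n × Bits n × (Fin t → Bits n) × (Fin t → Bits n)) :=
    fun (x, x', xs, xs', a, c, y, y', ys, ys') => ((x, xs, a), (ext (x, y),
      (fun i => ext (xs i, ys i)), x', xs', c, y, y', ys, ys'))
  have he : Function.Injective e := by
    rintro ⟨x, x', xs, xs', a, c, y, y', ys, ys'⟩ ⟨x₂, x₂', xs₂, xs₂', a₂, c₂, y₂, y₂', ys₂, ys₂'⟩ h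
    simp only [e, Prod.mk.injEq] at h ⊢
    tauto
  rw [sum_comp_injective he]
  · refine Finset.sum_congr rfl ?_
    rintro ⟨x, x', xs, xs', a, c, y, y', ys, ys'⟩ _
    simp only [e, withOutputs, true_and, and_true]
    split_ifs <;> simp
  · rintro ⟨⟨x, xs, a⟩, s', ss', x', xs', c, y, y', ys, ys'⟩ hb
    simp only [withOutputs]
    rw [if_neg]
    · simp
    · rintro ⟨-, rfl, -, rfl⟩
      exact hb (x, x', xs, xs', a, c, y, y', ys, ys') rfl

variable [DecidableEq N]

/-- Reading only the diagonal and then forgetting `P` cannot increase the norm. -/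
lemma sum_abs_view_le_traceNorm {R P : Type} [Fintype R] [Fintype P]
    {V : Matrix (Bits m × R × P) (Bits m × R × P) ℂ} (hV : V.IsHermitian) {w : Bits m → R → ℝ}
    (hw : ∀ s r, ∑ p, V (s, r, p) (s, r, p) = w s r) :
    ∑ s, ∑ r, |w s r - (2 ^ m)⁻¹ * ∑ s', w s' r| ≤
      traceNorm (V - classicalState (uniform m) ⊗ₖ traceFst V) := by
  classical
  have hT : (traceFst V).IsHermitian := by
    ext b b'
    simp only [traceFst, Matrix.conjTranspose_apply, Matrix.of_apply, star_sum]
    exact Finset.sum_congr rfl fun a _ => hV.apply _ _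
  have hU : (classicalState (uniform m)).IsHermitian := by
    refine Matrix.isHermitian_diagonal_of_self_adjoint _ ?_
    ext i
    simp
  have hH : (V - classicalState (uniform m) ⊗ₖ traceFst V).IsHermitian := by
    refine hV.sub ?_
    rw [Matrix.IsHermitian, Matrix.conjTranspose_kronecker, hU, hT]
  refine le_trans ?_ (sum_norm_diag_le_traceNorm hH)
  rw [Fintype.sum_prod_type]
  refine Finset.sum_le_sum fun s _ => ?_
  rw [Fintype.sum_prod_type]
  refine Finset.sum_le_sum fun r _ => ?_
  refine le_trans (le_of_eq ?_) (norm_sum_le _ _)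
  rw [← Real.norm_eq_abs, ← Complex.norm_real]
  congr 1
  have huni : classicalState (uniform m) s s = (2 ^ m)⁻¹ := by
    simp [classicalState, uniform]
  simp only [Matrix.sub_apply, Matrix.kronecker_apply, huni, traceFst, Matrix.of_apply]
  rw [Finset.sum_sub_distrib, ← Finset.mul_sum, Finset.sum_comm (γ := P), hw]
  simp_rw [hw]
  push_cast
  rfl

end View

/-! ### The extractor bound for filtered experiments -/

section Key

variable {n m t : ℕ} {N M N₀ M₀ : Type} [Fintype N] [Fintype M] [Fintype N₀] [Fintype M₀]
  [DecidableEq N] [DecidableEq M]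

/-- Weight of `(x, y, a, c)` for uniform `x`, `y`, when the operators `K x` and `L y` are applied to the
shared state `ψ`. -/
def weight (K : Bits n → Matrix N N₀ ℂ) (L : Bits n → Matrix M M₀ ℂ) (ψ : N₀ × M₀ → ℂ)
    (q : Bits n × Bits n × N × M) : ℝ :=
  (4 ^ n)⁻¹ * ‖∑ a₀, ∑ c₀, K q.1 q.2.2.1 a₀ * L q.2.1 q.2.2.2 c₀ * ψ (a₀, c₀)‖ ^ 2

/-- The weights, divided by their total `p`, are the squared amplitudes of a pure state whose basis
labels `a`, `c` serve as the registers `N`, `M`; the tampered words are read off by `g`, `h`. The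
extractor applies to this state, and scaling back turns `ε` into `ε * p`. -/
lemma sum_abs_output_le {k ε : ℝ} {ext : Bits n × Bits n → Bits m}
    (hext : IsQuantumSecureNMExt t ((n : ℝ) - k) ((n : ℝ) - k) ε ext)
    {K : Bits n → Matrix N N₀ ℂ} {L : Bits n → Matrix M M₀ ℂ} (hK : ∀ x, IsContraction (K x))
    (hL : ∀ y, IsContraction (L y)) {ψ : N₀ × M₀ → ℂ} (hψ : IsPureState ψ)
    (hp : (2 : ℝ) ^ (-k) ≤ ∑ q, weight K L ψ q)
    {g : Bits n → N → Fin t → Bits n} {h : Bits n → M → Fin t → Bits n}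
    (hfix : ∀ i, (∀ x y a c, weight K L ψ (x, y, a, c) ≠ 0 → y ≠ h y c i) ∨
      (∀ x y a c, weight K L ψ (x, y, a, c) ≠ 0 → x ≠ g x a i)) :
    ∑ s, ∑ ss, |(∑ q : Bits n × Bits n × N × M, if s = ext (q.1, q.2.1) ∧
          (ss = fun i => ext (g q.1 q.2.2.1 i, h q.2.1 q.2.2.2 i)) then weight K L ψ q else 0) -
        (2 ^ m)⁻¹ * ∑ s', ∑ q : Bits n × Bits n × N × M, if s' = ext (q.1, q.2.1) ∧
          (ss = fun i => ext (g q.1 q.2.2.1 i, h q.2.1 q.2.2.2 i)) then weight K L ψ q else 0| ≤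
      ε * ∑ q, weight K L ψ q := by
  set p := ∑ q, weight K L ψ q with hpdef
  have hp0 : 0 < p := (Real.rpow_pos_of_pos two_pos _).trans_le hp
  -- `r ^ 2` is the density of a uniform pair divided by the weight of the event. The entropy
  -- condition becomes `2 ^ n * r ^ 2 ≤ 2 ^ (k - n)`, which is where `p ≥ 2 ^ (-k)` enters.
  set r : ℝ := √((4 ^ n)⁻¹ / p) with hr
  have hr2 : r ^ 2 = (4 ^ n)⁻¹ / p := Real.sq_sqrt (by positivity)
  have hr0 : r ≠ 0 := by
    have : 0 < r := Real.sqrt_pos.2 (by positivity)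
    exact this.ne'
  set f : Bits n × Bits n × N × M → ℂ := fun q =>
    ∑ a₀, ∑ c₀, K q.1 q.2.2.1 a₀ * L q.2.1 q.2.2.2 c₀ * (r * ψ (a₀, c₀)) with hf
  have hf2 : ∀ q, ‖f q‖ ^ 2 = weight K L ψ q / p := by
    intro q
    have : f q = r * ∑ a₀, ∑ c₀, K q.1 q.2.2.1 a₀ * L q.2.1 q.2.2.2 c₀ * ψ (a₀, c₀) := by
      simp only [hf, Finset.mul_sum]
      exact Finset.sum_congr rfl fun a₀ _ => Finset.sum_congr rfl fun c₀ _ => by ring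
    rw [this, norm_mul, mul_pow, Complex.norm_real, Real.norm_eq_abs, sq_abs, hr2, weight]
    ring
  have hone : IsPureState f := by
    unfold IsPureState
    simp_rw [hf2]
    rw [← Finset.sum_div, ← hpdef, div_self hp0.ne']
  have hqma : IsQMAState ((n : ℝ) - k) ((n : ℝ) - k) (copied f) := by
    refine isQMAState_copied hK hL (φ := fun a₀ c₀ => r * ψ (a₀, c₀)) (fun _ _ _ _ => rfl) hone ?_
    have hs : ∑ a₀, ∑ c₀, ‖(r : ℂ) * ψ (a₀, c₀)‖ ^ 2 = (4 ^ n)⁻¹ / p := by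
      simp_rw [norm_mul, mul_pow, Complex.norm_real, Real.norm_eq_abs, sq_abs, hr2,
        ← Finset.mul_sum]
      have := hψ
      unfold IsPureState at this
      rw [Fintype.sum_prod_type] at this
      rw [this, mul_one]
    rw [hs, neg_sub, sub_eq_add_neg, Real.rpow_add two_pos, Real.rpow_neg two_pos.le (n : ℝ),
      Real.rpow_natCast]
    have h4 : (4 : ℝ) ^ n = 2 ^ n * 2 ^ n := by
      rw [← mul_pow]
      norm_num
    have h2k : (2 : ℝ) ^ k * (2 : ℝ) ^ (-k) = 1 := by
      rw [← Real.rpow_add two_pos]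
      simp
    have hkpos : (0 : ℝ) < 2 ^ k := Real.rpow_pos_of_pos two_pos _
    have hinv : 1 / p ≤ (2 : ℝ) ^ k := by
      rw [div_le_iff₀ hp0, ← h2k]
      exact mul_le_mul_of_nonneg_left hp hkpos.le
    calc (2 : ℝ) ^ n * ((4 ^ n)⁻¹ / p) = 1 / p * (2 ^ n)⁻¹ := by
          rw [h4]
          field_simp
      _ ≤ _ := mul_le_mul_of_nonneg_right hinv (by positivity)
  have hsupp : ∀ q, f q ≠ 0 → weight K L ψ q ≠ 0 := by
    intro q hq hw
    have := hf2 q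
    rw [hw, zero_div, sq_eq_zero_iff, norm_eq_zero] at this
    exact hq this
  have hqnm := isQNMState_tamper_copied hqma hone (g := g) (h := h) fun i =>
    (hfix i).imp (fun hi x y a c hq => hi x y a c (hsupp _ hq))
      (fun hi x y a c hq => hi x y a c (hsupp _ hq))
  have hbound := (hext N M _ hqnm).1
  set w : Bits m → (Fin t → Bits m) → ℝ := fun s ss =>
    ∑ q : Bits n × Bits n × N × M, if s = ext (q.1, q.2.1) ∧
          (ss = fun i => ext (g q.1 q.2.2.1 i, h q.2.1 q.2.2.2 i)) then weight K L ψ q else 0 with hw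
  have hview : ∀ s ss, ∑ x : Bits n × (Fin t → Bits n) × N,
      viewX ext (tamper (recordOp g) (recordOp h) (copied f)) (s, ss, x) (s, ss, x) =
        ((w s ss / p : ℝ) : ℂ) := by
    intro s ss
    rw [sum_viewX_diag]
    congr 1
    rw [sum_comp_injective (tamperEmb_injective g h), hw, Finset.sum_div]
    · refine Finset.sum_congr rfl fun q _ => ?_
      rw [tamper_copied_tamperEmb, hf2]
      rw [ite_div, zero_div]
      exact if_congr Iff.rfl rfl rfl
    · intro b hb
      rw [tamper_copied_eq_zero g h f hb]
      simp
  have hmain := (sum_abs_view_le_traceNorm (isHermitian_marginal _) hview).trans hbound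
  have hscale : ∀ s ss, |w s ss / p - (2 ^ m)⁻¹ * ∑ s', w s' ss / p| =
      |w s ss - (2 ^ m)⁻¹ * ∑ s', w s' ss| / p := by
    intro s ss
    rw [← Finset.sum_div, ← mul_div_assoc, ← sub_div, abs_div, abs_of_pos hp0]
  simp_rw [hscale, ← Finset.sum_div] at hmain
  rwa [div_le_iff₀ hp0] at hmain

end Key

/-! ### Error accounting over the tampering classes -/

section Simulation

/-- Points where `f` and `f'` agree cancel; every other point is counted at most twice. -/
lemma sum_abs_fiber_sub_fiber_le {Q K : Type} [Fintype Q] [Fintype K] [DecidableEq K]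
    (f f' : Q → K) {ν : Q → ℝ} (hν : ∀ q, 0 ≤ ν q) :
    ∑ k, |(∑ q, if f q = k then ν q else 0) - ∑ q, if f' q = k then ν q else 0| ≤
      2 * ∑ q, if f q = f' q then 0 else ν q := by
  have h : ∀ k, (∑ q, if f q = k then ν q else 0) - (∑ q, if f' q = k then ν q else 0) =
      (∑ q, if f q = k then (if f q = f' q then 0 else ν q) else 0) -
        ∑ q, if f' q = k then (if f q = f' q then 0 else ν q) else 0 := by
    intro k
    rw [← Finset.sum_sub_distrib, ← Finset.sum_sub_distrib]
    refine Finset.sum_congr rfl fun q _ => ?_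
    by_cases hq : f q = f' q
    · simp [hq]
    · simp [hq]
  have habs : ∀ q, |if f q = f' q then 0 else ν q| = if f q = f' q then 0 else ν q := by
    intro q
    split_ifs
    · simp
    · exact abs_of_nonneg (hν q)
  simp_rw [h]
  refine (Finset.sum_le_sum fun k _ => abs_sub _ _).trans ?_
  rw [Finset.sum_add_distrib, two_mul]
  refine add_le_add ?_ ?_
  · refine (sum_abs_fiber_le f _).trans (le_of_eq (Finset.sum_congr rfl fun q _ => habs q))
  · refine (sum_abs_fiber_le f' _).trans (le_of_eq (Finset.sum_congr rfl fun q _ => habs q))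

section Coarse

variable {Q S R W : Type} [Fintype Q] [Fintype S] [Fintype R] [Fintype W]
  [DecidableEq S] [DecidableEq R] [DecidableEq W]

/-- For each fixed `s`, `F s` is a coarse-graining of `R`. Thus closeness of `(S, S^[t])` to a
product survives filling `same` with the message `s`. -/
lemma sum_abs_joint_sub_product_le (κ : ℝ) (src : Q → S) (r : Q → R) (F : S → R → W) (ν : Q → ℝ) :
    ∑ s, ∑ w, |(∑ q, if src q = s ∧ F s (r q) = w then ν q else 0) -
        κ * ∑ q, if F s (r q) = w then ν q else 0| ≤
      ∑ s, ∑ u, |(∑ q, if s = src q ∧ u = r q then ν q else 0) -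
        κ * ∑ s', ∑ q, if s' = src q ∧ u = r q then ν q else 0| := by
  refine Finset.sum_le_sum fun s _ => ?_
  refine le_trans (le_of_eq (Finset.sum_congr rfl fun w _ => congrArg abs ?_))
    (sum_abs_fiber_le (F s) _)
  have h1 : ∀ u, (∑ s', ∑ q, if s' = src q ∧ u = r q then ν q else 0) =
      ∑ q, if u = r q then ν q else 0 := by
    intro u
    rw [Finset.sum_comm]
    simp [ite_and]
  simp_rw [h1]
  have h2 : ∀ u, (if F s u = w then ((∑ q, if s = src q ∧ u = r q then ν q else 0) -
        κ * ∑ q, if u = r q then ν q else 0) else 0) =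
      (∑ q, if u = r q then (if s = src q ∧ F s u = w then ν q else 0) else 0) -
        κ * ∑ q, if u = r q then (if F s u = w then ν q else 0) else 0 := by
    intro u
    by_cases hu : F s u = w
    · simp only [hu, if_true, and_true]
      congr 1
      exact Finset.sum_congr rfl fun q _ => by
        by_cases h3 : s = src q <;> by_cases h4 : u = r q <;> simp [h3, h4]
    · simp [hu]
  simp_rw [h2]
  rw [Finset.sum_sub_distrib, ← Finset.mul_sum, Finset.sum_comm]
  conv_rhs => rw [Finset.sum_comm (γ := R)]
  simp [eq_comm]

/-- The trivial bound, used for light classes: both terms are nonnegative with total mass `∑ q, ν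
q`, the second because `κ * card S = 1`. -/
lemma sum_abs_joint_sub_product_le_two_mul {κ : ℝ} (hκ : κ * Fintype.card S = 1) (hκ0 : 0 ≤ κ)
    (src : Q → S) (F : S → Q → W) {ν : Q → ℝ} (hν : ∀ q, 0 ≤ ν q) :
    ∑ s, ∑ w, |(∑ q, if src q = s ∧ F s q = w then ν q else 0) -
        κ * ∑ q, if F s q = w then ν q else 0| ≤ 2 * ∑ q, ν q := by
  have hn : ∀ p : Prop, ∀ [Decidable p], ∀ q, 0 ≤ if p then ν q else 0 := by
    intro p _ q
    split_ifs
    · exact hν q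
    · exact le_rfl
  calc _ ≤ ∑ s, ∑ w, ((∑ q, if src q = s ∧ F s q = w then ν q else 0) +
        κ * ∑ q, if F s q = w then ν q else 0) := by
        refine Finset.sum_le_sum fun s _ => Finset.sum_le_sum fun w _ => (abs_sub _ _).trans ?_
        rw [abs_of_nonneg (Finset.sum_nonneg fun q _ => hn _ q),
          abs_of_nonneg (mul_nonneg hκ0 (Finset.sum_nonneg fun q _ => hn _ q))]
    _ = ∑ s, ((∑ q, if src q = s then ν q else 0) + κ * ∑ q, ν q) := by
        refine Finset.sum_congr rfl fun s _ => ?_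
        rw [Finset.sum_add_distrib, ← Finset.mul_sum, Finset.sum_comm,
          Finset.sum_comm (γ := W) (f := fun w q => if F s q = w then ν q else 0)]
        simp [ite_and]
    _ = 2 * ∑ q, ν q := by
        rw [Finset.sum_add_distrib, Finset.sum_comm, Finset.sum_const, Finset.card_univ,
          nsmul_eq_mul, ← mul_assoc, mul_comm _ κ, hκ]
        simp [two_mul]

end Coarse

/-- Equality holds at `t = 1` and `t = 2`, so the `- 1` cannot be dropped; this is why one class
must be spared in the counts below. -/
lemma two_mul_three_pow_sub_one_le (t : ℕ) (ht : 0 < t) :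
    2 * ((3 : ℝ) ^ t - 1) ≤ 2 ^ (2 * t) := by
  induction t, ht using Nat.le_induction with
  | base => norm_num
  | succ t ht ih =>
    have h3 : (3 : ℝ) ^ 1 ≤ 3 ^ t := pow_le_pow_right₀ (by norm_num) ht
    have h2 : (2 : ℝ) ^ (2 * (t + 1)) = 4 * 2 ^ (2 * t) := by ring
    have h3' : (3 : ℝ) ^ (t + 1) = 3 * 3 ^ t := by ring
    rw [h2, h3']
    linarith

variable {m t : ℕ}

/-- The outputs of the tampered codewords, with `same` for the untouched ones. -/
def maskSame (c : Fin t → Option Bool) (ss : Fin t → Bits m) : Fin t → Option (Bits m) :=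
  fun i => if c i = some true then none else some (ss i)

/-- The error is `ε` for replacing `ν` by `μ`, plus one term per class: `ε * p c` for heavy ones,
adding up to at most `ε`, and at most `2 * δ` for light ones. The class given by `hex` is spared
from the latter count. -/
lemma sum_abs_sub_simulated_le_of_class {Q : Type} [Fintype Q] {μ ν : Q → ℝ} {ε δ : ℝ}
    (hμ : ∀ q, 0 ≤ μ q) (hμ1 : ∑ q, μ q = 1) (hε : 0 ≤ ε) (hδ : 0 ≤ δ) (ht : 0 < t)
    {src : Q → Bits m} {cls : Q → Fin t → Option Bool} {out : Q → Fin t → Bits m}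
    (hsame : ∀ q i, cls q i = some true → out q i = src q)
    (hνμ : ∑ q, |ν q - μ q| ≤ ε)
    (hclass : ∀ c, δ ≤ (∑ q, if cls q = c then μ q else 0) →
      ∑ s, ∑ w, |(∑ q, if src q = s ∧ copyTuple (maskSame c (out q)) s = w then
          (if cls q = c then μ q else 0) else 0) -
        (2 ^ m)⁻¹ * ∑ q, if copyTuple (maskSame c (out q)) s = w then
          (if cls q = c then μ q else 0) else 0| ≤ ε * ∑ q, if cls q = c then μ q else 0)
    (hex : ∃ c, δ ≤ ∑ q, if cls q = c then μ q else 0) :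
    ∑ s, ∑ w, |(∑ q, if src q = s ∧ (fun i => some (out q i)) = w then ν q else 0) -
        (2 ^ m)⁻¹ * ∑ q, if copyTuple (maskSame (cls q) (out q)) s = w then μ q else 0| ≤
      2 ^ (2 * t) * (δ + ε) + ε := by
  classical
  set p : (Fin t → Option Bool) → ℝ := fun c => ∑ q, if cls q = c then μ q else 0 with hp
  set Δ : (Fin t → Option Bool) → Bits m → (Fin t → Option (Bits m)) → ℝ := fun c s w =>
    (∑ q, if src q = s ∧ copyTuple (maskSame c (out q)) s = w then
      (if cls q = c then μ q else 0) else 0) -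
    (2 ^ m)⁻¹ * ∑ q, if copyTuple (maskSame c (out q)) s = w then
      (if cls q = c then μ q else 0) else 0 with hΔ
  -- By `hsame`, filling in the true message undoes the mask.
  have hout : ∀ q, (fun i => some (out q i)) = copyTuple (maskSame (cls q) (out q)) (src q) := by
    intro q
    ext1 i
    by_cases hi : cls q i = some true
    · simp [copyTuple, maskSame, hi, hsame q i hi]
    · simp [copyTuple, maskSame, hi]
  have hdecomp : ∀ s w, (∑ q, if src q = s ∧ (fun i => some (out q i)) = w then ν q else 0) -
        (2 ^ m)⁻¹ * (∑ q, if copyTuple (maskSame (cls q) (out q)) s = w then μ q else 0) =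
      (∑ q, if (src q, fun i => some (out q i)) = (s, w) then ν q - μ q else 0) +
        ∑ c, Δ c s w := by
    intro s w
    have h1 : (∑ c, ∑ q, if src q = s ∧ copyTuple (maskSame c (out q)) s = w then
        (if cls q = c then μ q else 0) else 0) =
        ∑ q, if src q = s ∧ (fun i => some (out q i)) = w then μ q else 0 := by
      rw [Finset.sum_comm]
      refine Finset.sum_congr rfl fun q _ => ?_
      rw [Finset.sum_eq_single (cls q)]
      · rw [if_pos rfl]
        by_cases hs : src q = s
        · subst hs
          rw [← hout q]
        · simp [hs]
      · intro c _ hc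
        simp [Ne.symm hc]
      · simp
    have h2 : (∑ c, ∑ q, if copyTuple (maskSame c (out q)) s = w then
        (if cls q = c then μ q else 0) else 0) =
        ∑ q, if copyTuple (maskSame (cls q) (out q)) s = w then μ q else 0 := by
      rw [Finset.sum_comm]
      refine Finset.sum_congr rfl fun q _ => ?_
      rw [Finset.sum_eq_single (cls q)]
      · rw [if_pos rfl]
      · intro c _ hc
        simp [Ne.symm hc]
      · simp
    simp only [hΔ]
    rw [Finset.sum_sub_distrib, ← Finset.mul_sum, h1, h2, ← add_sub_assoc,
      ← Finset.sum_add_distrib]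
    congr 1
    refine Finset.sum_congr rfl fun q _ => ?_
    simp only [Prod.mk.injEq]
    split_ifs <;> ring
  have hp0 : ∀ c, 0 ≤ p c := fun c => Finset.sum_nonneg fun q _ => by
    split_ifs
    · exact hμ q
    · exact le_rfl
  have hp1 : ∑ c, p c = 1 := by
    rw [hp, Finset.sum_comm, ← hμ1]
    simp
  have hbad : ∀ c, ∑ s, ∑ w, |Δ c s w| ≤ 2 * p c := by
    intro c
    refine sum_abs_joint_sub_product_le_two_mul (κ := (2 ^ m)⁻¹) (by simp) (by positivity) src
      (fun s q => copyTuple (maskSame c (out q)) s) fun q => ?_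
    split_ifs
    · exact hμ q
    · exact le_rfl
  have hterm : ∀ c, ∑ s, ∑ w, |Δ c s w| ≤ ε * p c + if δ ≤ p c then 0 else 2 * δ := by
    intro c
    by_cases hc : δ ≤ p c
    · rw [if_pos hc, add_zero]
      exact hclass c hc
    · rw [if_neg hc]
      have := hbad c
      have := mul_nonneg hε (hp0 c)
      linarith
  obtain ⟨c₀, hc₀⟩ := hex
  have hcount : (∑ c, if δ ≤ p c then 0 else 2 * δ) ≤ 2 ^ (2 * t) * δ := by
    calc (∑ c, if δ ≤ p c then 0 else 2 * δ)
        ≤ ∑ c, if c = c₀ then 0 else 2 * δ := by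
          refine Finset.sum_le_sum fun c _ => ?_
          by_cases hc : c = c₀
          · rw [if_pos hc, hc, if_pos hc₀]
          · rw [if_neg hc]
            split_ifs
            · positivity
            · exact le_rfl
      _ = 2 * ((3 : ℝ) ^ t - 1) * δ := by
          have : ∀ c, (if c = c₀ then 0 else 2 * δ) = 2 * δ - if c = c₀ then 2 * δ else 0 := by
            intro c
            split_ifs <;> ring
          simp_rw [this]
          rw [Finset.sum_sub_distrib]
          simp
          ring
      _ ≤ _ := mul_le_mul_of_nonneg_right (two_mul_three_pow_sub_one_le t ht) hδ
  have hsum : ∑ c, ∑ s, ∑ w, |Δ c s w| ≤ ε + 2 ^ (2 * t) * δ := by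
    refine (Finset.sum_le_sum fun c _ => hterm c).trans ?_
    rw [Finset.sum_add_distrib, ← Finset.mul_sum, hp1, mul_one]
    linarith
  have hswap : ∑ s, ∑ w, |∑ q, if (src q, fun i => some (out q i)) = (s, w) then
      ν q - μ q else 0| ≤ ε := by
    rw [← Fintype.sum_prod_type' (f := fun s w => |∑ q, if (src q, fun i => some (out q i)) = (s, w)
      then ν q - μ q else 0|)]
    exact (sum_abs_fiber_le (fun q => (src q, fun i => some (out q i))) _).trans hνμ
  simp_rw [hdecomp]
  have hone : (1 : ℝ) ≤ 2 ^ (2 * t) := one_le_pow₀ (by norm_num)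
  calc _ ≤ ∑ s, ∑ w, (|∑ q, if (src q, fun i => some (out q i)) = (s, w) then
        ν q - μ q else 0| + ∑ c, |Δ c s w|) :=
        Finset.sum_le_sum fun s _ => Finset.sum_le_sum fun w _ =>
          (abs_add_le _ _).trans (add_le_add le_rfl (Finset.abs_sum_le_sum_abs _ _))
    _ = (∑ s, ∑ w, |∑ q, if (src q, fun i => some (out q i)) = (s, w) then
        ν q - μ q else 0|) + ∑ c, ∑ s, ∑ w, |Δ c s w| := by
        simp_rw [Finset.sum_add_distrib]
        congr 1
        rw [Finset.sum_comm]
        conv_rhs => rw [Finset.sum_comm]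
        conv_lhs => rw [Finset.sum_comm]
        refine Finset.sum_congr rfl fun s _ => ?_
        rw [Finset.sum_comm]
    _ ≤ ε + (ε + 2 ^ (2 * t) * δ) := add_le_add hswap hsum
    _ ≤ _ := by nlinarith

/-- Always answering `same` errs only outside the class `c₀` of entirely untouched codewords. That
event has `μ`-weight at most `(3 ^ t - 1) * δ`, and `ν`-weight larger by at most `ε`. -/
lemma sum_abs_sub_same_le_of_class {Q : Type} [Fintype Q] {μ ν : Q → ℝ} {ε δ : ℝ}
    (hν : ∀ q, 0 ≤ ν q) (hε : 0 ≤ ε) (hδ : 0 ≤ δ) (ht : 0 < t)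
    {src : Q → Bits m} {cls : Q → Fin t → Option Bool} {out : Q → Fin t → Bits m}
    (hsame : ∀ q i, cls q i = some true → out q i = src q)
    (hνμ : ∑ q, |ν q - μ q| ≤ ε)
    (hνs : ∀ s, (∑ q, if src q = s then ν q else 0) = (2 ^ m)⁻¹)
    (hall : ∀ c, (∑ q, if cls q = c then μ q else 0) < δ) :
    ∑ s, ∑ w, |(∑ q, if src q = s ∧ (fun i => some (out q i)) = w then ν q else 0) -
        (2 ^ m)⁻¹ * if (copyTuple (fun _ => none) s : Fin t → Option (Bits m)) = w then 1 else 0| ≤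
      2 ^ (2 * t) * (δ + ε) + ε := by
  classical
  set f : Q → Bits m × (Fin t → Option (Bits m)) := fun q => (src q, fun i => some (out q i)) with hf
  set f' : Q → Bits m × (Fin t → Option (Bits m)) := fun q => (src q, fun _ => some (src q)) with hf'
  have hrw : ∀ s w, (∑ q, if src q = s ∧ (fun i => some (out q i)) = w then ν q else 0) -
        (2 ^ m)⁻¹ * (if (copyTuple (fun _ => none) s : Fin t → Option (Bits m)) = w then 1 else 0) =
      (∑ q, if f q = (s, w) then ν q else 0) - ∑ q, if f' q = (s, w) then ν q else 0 := by
    intro s w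
    congr 1
    · simp [hf]
    · rw [← hνs s, Finset.sum_mul]
      refine Finset.sum_congr rfl fun q _ => ?_
      by_cases hs : src q = s
      · simp [hf', hs, show (copyTuple (fun _ => none) s : Fin t → Option (Bits m)) =
          fun _ => some s from rfl]
      · simp [hf', hs]
  simp_rw [hrw]
  rw [← Fintype.sum_prod_type' (f := fun s w => |(∑ q, if f q = (s, w) then ν q else 0) -
    ∑ q, if f' q = (s, w) then ν q else 0|)]
  refine (sum_abs_fiber_sub_fiber_le f f' hν).trans ?_
  set c₀ : Fin t → Option Bool := fun _ => some true with hc₀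
  have hle : (∑ q, if f q = f' q then 0 else ν q) ≤
      (∑ q, |ν q - μ q|) + ∑ c, if c = c₀ then 0 else ∑ q, if cls q = c then μ q else 0 := by
    have h1 : (∑ c, if c = c₀ then 0 else ∑ q, if cls q = c then μ q else 0) =
        ∑ q, if cls q = c₀ then 0 else μ q := by
      have : ∀ c, (if c = c₀ then 0 else ∑ q, if cls q = c then μ q else 0) =
          ∑ q, if cls q = c then (if c = c₀ then 0 else μ q) else 0 := by
        intro c
        split_ifs <;> simp
      simp_rw [this]
      rw [Finset.sum_comm]
      simp
    rw [h1, ← Finset.sum_add_distrib]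
    refine Finset.sum_le_sum fun q _ => ?_
    by_cases hq : cls q = c₀
    · have : f q = f' q := by
        simp only [hf, hf', Prod.mk.injEq, true_and]
        ext1 i
        rw [hsame q i (by rw [hq])]
      rw [if_pos this, if_pos hq, add_zero]
      exact abs_nonneg _
    · rw [if_neg hq]
      have h2 := le_abs_self (ν q - μ q)
      split_ifs
      · linarith [hν q]
      · linarith
  have hcount : (∑ c, if c = c₀ then 0 else ∑ q, if cls q = c then μ q else 0) ≤
      ((3 : ℝ) ^ t - 1) * δ := by
    calc _ ≤ ∑ c, (δ - if c = c₀ then δ else 0) := by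
          refine Finset.sum_le_sum fun c _ => ?_
          split_ifs
          · simp
          · linarith [hall c]
      _ = _ := by
          rw [Finset.sum_sub_distrib]
          simp
          ring
  have hone : (1 : ℝ) ≤ 2 ^ (2 * t) := one_le_pow₀ (by norm_num)
  nlinarith [mul_le_mul_of_nonneg_right (two_mul_three_pow_sub_one_le t ht) hδ]

end Simulation

/-! ### Isometries with one input register fixed -/

section Isometry

lemma IsIsometry.sum_norm_sq {A B : Type} [Fintype A] [Fintype B] [DecidableEq A]
    {U : Matrix B A ℂ} (hU : IsIsometry U) (v : A → ℂ) :
    ∑ b, ‖∑ a, U b a * v a‖ ^ 2 = ∑ a, ‖v a‖ ^ 2 := by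
  have hnorm : ∀ {C : Type} [Fintype C] (u : C → ℂ),
      star u ⬝ᵥ u = ((∑ c, ‖u c‖ ^ 2 : ℝ) : ℂ) := by
    intro C _ u
    simp only [dotProduct, Pi.star_apply, RCLike.star_def, RCLike.conj_mul]
    norm_cast
  have h : star (U *ᵥ v) ⬝ᵥ (U *ᵥ v) = star v ⬝ᵥ v := by
    rw [Matrix.star_mulVec, Matrix.dotProduct_mulVec, Matrix.vecMul_vecMul, hU, Matrix.vecMul_one]
  rw [hnorm, hnorm] at h
  exact_mod_cast h

variable {X N B : Type} [Fintype X] [Fintype N] [Fintype B] [DecidableEq X] [DecidableEq N]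

lemma IsIsometry.sum_norm_sq_slice {U : Matrix B (X × N) ℂ} (hU : IsIsometry U) (x : X)
    (v : N → ℂ) : ∑ b, ‖∑ a, U b (x, a) * v a‖ ^ 2 = ∑ a, ‖v a‖ ^ 2 := by
  have h := hU.sum_norm_sq fun p => if p.1 = x then v p.2 else 0
  have h1 : ∀ b, ∑ p : X × N, U b p * (if p.1 = x then v p.2 else 0) =
      ∑ a, U b (x, a) * v a := by
    intro b
    rw [Fintype.sum_prod_type, Finset.sum_eq_single x] <;> simp +contextual
  have h2 : ∑ p : X × N, ‖if p.1 = x then v p.2 else 0‖ ^ 2 = ∑ a, ‖v a‖ ^ 2 := by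
    rw [Fintype.sum_prod_type, Finset.sum_eq_single x] <;> simp +contextual
  simp_rw [h1] at h
  rw [h, h2]

/-- An isometry followed by the coordinate projection onto `E`. -/
lemma IsIsometry.isContraction_slice {U : Matrix B (X × N) ℂ} (hU : IsIsometry U) (x : X)
    (E : B → Prop) [DecidablePred E] :
    IsContraction (Matrix.of fun b a => if E b then U b (x, a) else 0) := by
  intro v
  rw [← hU.sum_norm_sq_slice x v]
  refine Finset.sum_le_sum fun b _ => ?_
  by_cases hb : E b
  · simp [hb]
  · calc _ = (0 : ℝ) := by simp [hb]
      _ ≤ _ := by positivity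

end Isometry

/-! ### Near-uniformity of `ext` on uniform sources -/

section SourceSwap

variable {n m t : ℕ}

/-- Number of codewords of the message `s`. -/
def fiberCard (ext : Bits n × Bits n → Bits m) (s : Bits m) : ℕ :=
  (Finset.univ.filter fun c => ext c = s).card

lemma sum_abs_fiberCard_sub_le (hn : 0 < n) {k ε : ℝ} (hk : 0 < k)
    {ext : Bits n × Bits n → Bits m}
    (hext : IsQuantumSecureNMExt t ((n : ℝ) - k) ((n : ℝ) - k) ε ext) :
    ∑ s, |(4 ^ n : ℝ)⁻¹ * fiberCard ext s - (2 ^ m)⁻¹| ≤ ε := by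
  have hψ : IsPureState (fun _ : Unit × Unit => (1 : ℂ)) := by simp [IsPureState]
  have hw : ∀ q, weight (fun _ : Bits n => (1 : Matrix Unit Unit ℂ))
      (fun _ : Bits n => (1 : Matrix Unit Unit ℂ)) (fun _ => (1 : ℂ)) q = (4 ^ n)⁻¹ := by
    intro q
    simp [weight]
  have h4 : (4 : ℝ) ^ n = 2 ^ n * 2 ^ n := by
    rw [← mul_pow]
    norm_num
  have htot : ∑ _q : Bits n × Bits n × Unit × Unit, (4 ^ n : ℝ)⁻¹ = 1 := by
    rw [Finset.sum_const, Finset.card_univ, nsmul_eq_mul, h4]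
    have : (Fintype.card (Bits n × Bits n × Unit × Unit) : ℝ) = 2 ^ n * 2 ^ n := by simp
    rw [this, mul_inv_cancel₀ (by positivity)]
  have h := sum_abs_output_le hext (K := fun _ => 1) (L := fun _ => 1)
    (fun _ => isContraction_one) (fun _ => isContraction_one) hψ
    (by
      simp_rw [hw]
      rw [htot]
      exact Real.rpow_le_one_of_one_le_of_nonpos one_le_two (by linarith))
    -- Trivial side registers, `X` complemented and `Y` left fixed: since `0 < n`, there is no fixed
    -- point in `X`.
    (g := fun x _ _ j => !x j) (h := fun y _ _ => y)
    (fun i => Or.inr fun x y a c _ hx => by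
      have := congrFun hx ⟨0, hn⟩
      simp at this)
  simp_rw [hw] at h
  rw [htot, mul_one] at h
  refine le_trans (Finset.sum_le_sum fun s _ => ?_) h
  refine le_trans (le_of_eq ?_) (Finset.abs_sum_le_sum_abs _ _)
  congr 1
  have hmarg : ∀ s : Bits m, (∑ ss : Fin t → Bits m, ∑ q : Bits n × Bits n × Unit × Unit,
      if s = ext (q.1, q.2.1) ∧ (ss = fun _ => ext (fun j => !q.1 j, q.2.1))
        then (4 ^ n : ℝ)⁻¹ else 0) = (4 ^ n)⁻¹ * fiberCard ext s := by
    intro s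
    rw [Finset.sum_comm]
    have : ∀ q : Bits n × Bits n × Unit × Unit, (∑ ss : Fin t → Bits m,
        if s = ext (q.1, q.2.1) ∧ (ss = fun _ => ext (fun j => !q.1 j, q.2.1))
          then (4 ^ n : ℝ)⁻¹ else 0) = if ext (q.1, q.2.1) = s then (4 ^ n : ℝ)⁻¹ else 0 := by
      intro q
      by_cases hs : s = ext (q.1, q.2.1)
      · simp [hs]
      · simp [hs, Ne.symm hs]
    simp_rw [this]
    rw [fiberCard, Finset.card_filter]
    push_cast
    rw [Finset.mul_sum]
    simp_rw [Fintype.sum_prod_type]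
    simp
  rw [Finset.sum_sub_distrib, ← Finset.mul_sum, hmarg, Finset.sum_comm]
  simp_rw [hmarg]
  congr 1
  have hall : ∑ s, (fiberCard ext s : ℝ) = 4 ^ n := by
    have h1 : ∑ s, fiberCard ext s = Fintype.card (Bits n × Bits n) :=
      (Finset.card_eq_sum_card_fiberwise (f := ext) (t := Finset.univ) (by simp [Set.MapsTo])).symm
    rw [h4]
    have h2 : ((∑ s, fiberCard ext s : ℕ) : ℝ) = (Fintype.card (Bits n × Bits n) : ℕ) := by rw [h1]
    simpa using h2
  rw [← Finset.mul_sum, hall, inv_mul_cancel₀ (by positivity), mul_one]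

end SourceSwap

/-! ### The tampering experiment and its classes -/

section Code

lemma mul_diagonal_kronecker_mul_conjTranspose_apply {A B C : Type} [Fintype A] [Fintype B]
    [Fintype C] [DecidableEq A] (O : Matrix C (A × B) ℂ) (p : A → ℂ) (ψ : B → ℂ) (i j : C) :
    (O * (Matrix.diagonal p ⊗ₖ Matrix.vecMulVec ψ (star ψ)) * Oᴴ) i j =
      ∑ e, p e * (∑ f, O i (e, f) * ψ f) * star (∑ f, O j (e, f) * ψ f) := by
  rw [Matrix.mul_apply, Fintype.sum_prod_type]
  refine Finset.sum_congr rfl fun e _ => ?_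
  have h : ∀ f, (O * (Matrix.diagonal p ⊗ₖ Matrix.vecMulVec ψ (star ψ))) i (e, f) =
      p e * (∑ f', O i (e, f') * ψ f') * star (ψ f) := by
    intro f
    rw [Matrix.mul_apply, Fintype.sum_prod_type, Finset.sum_eq_single e]
    · simp only [Matrix.kronecker_apply, Matrix.diagonal_apply_eq, Matrix.vecMulVec_apply,
        Pi.star_apply, Finset.mul_sum, Finset.sum_mul]
      exact Finset.sum_congr rfl fun f' _ => by ring
    · intro e' _ he'
      simp [Matrix.diagonal_apply_ne _ he']
    · simp
  simp_rw [h, Matrix.conjTranspose_apply, star_sum, star_mul', Finset.mul_sum]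
  exact Finset.sum_congr rfl fun f _ => by ring

variable {n m t : ℕ} {N M N' M' : Type} [Fintype N] [Fintype M] [Fintype N'] [Fintype M']

/-- Amplitude of `(X^[t], N') = u`, `(Y^[t], M') = v` after tampering with the codeword `(x, y)`. -/
def tamperAmp (U : Matrix ((Fin t → Bits n) × N') (Bits n × N) ℂ)
    (V : Matrix ((Fin t → Bits n) × M') (Bits n × M) ℂ) (ψ : N × M → ℂ) (x y : Bits n)
    (u : (Fin t → Bits n) × N') (v : (Fin t → Bits n) × M') : ℂ :=
  ∑ a, ∑ c, U u (x, a) * V v (y, c) * ψ (a, c)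

lemma tamperedState_apply (Enc : Bits m → PMF (Bits n × Bits n))
    (U : Matrix ((Fin t → Bits n) × N') (Bits n × N) ℂ)
    (V : Matrix ((Fin t → Bits n) × M') (Bits n × M) ℂ) (ψ : N × M → ℂ) (s s' u u' v v') :
    tamperedState Enc U V ψ (s, u, v) (s', u', v') =
      if s = s' then ∑ x, ∑ y, (((2 ^ m)⁻¹ * (Enc s (x, y)).toReal : ℝ) : ℂ) *
        tamperAmp U V ψ x y u v * star (tamperAmp U V ψ x y u' v') else 0 := by
  have hamp : ∀ (s s₁ : Bits m) x y u v, ∑ f : N × M, adversaryOp U V (s, u, v) ((s₁, x, y), f) * ψ f =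
      if s = s₁ then tamperAmp U V ψ x y u v else 0 := by
    intro s s₁ x y u v
    rw [Fintype.sum_prod_type]
    by_cases hs : s = s₁ <;> simp [adversaryOp, tamperAmp, hs]
  have hprob : ∀ x y, (((uniform m).bind fun s => (Enc s).map fun c => (s, c)) (s, x, y)).toReal =
      (2 ^ m)⁻¹ * (Enc s (x, y)).toReal := by
    intro x y
    rw [toReal_bind_apply, Finset.sum_eq_single s]
    · rw [toReal_map_apply, Finset.sum_eq_single (x, y)]
      · simp [uniform]
      · intro c _ hc
        simp [hc]
      · simp
    · intro s₁ _ hs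
      rw [toReal_map_apply]
      simp [hs]
    · simp
  unfold tamperedState encodedState classicalState
  rw [mul_diagonal_kronecker_mul_conjTranspose_apply, Fintype.sum_prod_type,
    Finset.sum_eq_single s]
  · rw [Fintype.sum_prod_type]
    simp_rw [hamp, hprob]
    by_cases hs : s = s'
    · simp [hs]
    · simp [hs, Ne.symm hs]
  · intro s₁ _ hs
    refine Finset.sum_eq_zero ?_
    rintro ⟨x, y⟩ _
    rw [hamp, if_neg (Ne.symm hs)]
    simp
  · simp

/-- The message register is classical and each measured outcome decodes to a single tuple, so no
off-diagonal entry survives and the trace norm in the goal becomes an ℓ¹ distance. -/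
lemma decodedState_tamperedState (Enc : Bits m → PMF (Bits n × Bits n))
    (Dec : Bits n × Bits n → Option (Bits m))
    (U : Matrix ((Fin t → Bits n) × N') (Bits n × N) ℂ)
    (V : Matrix ((Fin t → Bits n) × M') (Bits n × M) ℂ) (ψ : N × M → ℂ) :
    decodedState Dec (tamperedState Enc U V ψ) =
      Matrix.diagonal fun r => ((∑ xs, ∑ ys, ∑ a, ∑ c, if (fun i => Dec (xs i, ys i)) = r.2 then
        ∑ x, ∑ y, (2 ^ m)⁻¹ * (Enc r.1 (x, y)).toReal *
          ‖tamperAmp U V ψ x y (xs, a) (ys, c)‖ ^ 2 else 0 : ℝ) : ℂ) := by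
  ext ⟨s, w⟩ ⟨s', w'⟩
  by_cases h : (s, w) = (s', w')
  · obtain ⟨rfl, rfl⟩ := Prod.mk.inj h
    rw [Matrix.diagonal_apply_eq]
    simp only [decodedState, Matrix.of_apply, and_self, tamperedState_apply, if_true]
    push_cast
    refine Finset.sum_congr rfl fun xs _ => Finset.sum_congr rfl fun ys _ =>
      Finset.sum_congr rfl fun a _ => Finset.sum_congr rfl fun c _ => ?_
    split_ifs
    · push_cast
      refine Finset.sum_congr rfl fun x _ => Finset.sum_congr rfl fun y _ => ?_
      rw [mul_assoc (_ * _), RCLike.star_def, RCLike.mul_conj]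
      norm_cast
    · simp
  · rw [Matrix.diagonal_apply_ne _ h]
    simp only [decodedState, Matrix.of_apply, tamperedState_apply]
    refine Finset.sum_eq_zero fun xs _ => Finset.sum_eq_zero fun ys _ =>
      Finset.sum_eq_zero fun a _ => Finset.sum_eq_zero fun c _ => ?_
    split_ifs with h1 h2
    · exact absurd (Prod.ext h2 (h1.1.symm.trans h1.2)) h
    · rfl
    · rfl

lemma toReal_simulated_apply (D : PMF (Fin t → Option (Bits m))) (s : Bits m)
    (w : Fin t → Option (Bits m)) :
    (((uniform m).bind fun z => D.map fun d => (z, copyTuple d z)) (s, w)).toReal =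
      (2 ^ m)⁻¹ * ∑ d, if copyTuple d s = w then (D d).toReal else 0 := by
  rw [toReal_bind_apply, Finset.sum_eq_single s]
  · rw [toReal_map_apply]
    simp [uniform]
  · intro s₁ _ hs
    rw [toReal_map_apply]
    simp [hs]
  · simp

lemma toReal_preimageEnc (ext : Bits n × Bits n → Bits m) (h : Function.Surjective ext)
    (s : Bits m) (c : Bits n × Bits n) :
    (preimageEnc ext h s c).toReal = if ext c = s then (fiberCard ext s : ℝ)⁻¹ else 0 := by
  by_cases hc : ext c = s
  · have happly : preimageEnc ext h s c = (fiberCard ext s : ENNReal)⁻¹ :=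
      PMF.uniformOfFinset_apply_of_mem _ (Finset.mem_filter.2 ⟨Finset.mem_univ _, hc⟩)
    simp [happly, hc]
  · have happly : preimageEnc ext h s c = 0 :=
      PMF.uniformOfFinset_apply_of_notMem _ (by simp [hc])
    simp [happly, hc]

lemma isStandardScheme_preimageEnc (ext : Bits n × Bits n → Bits m)
    (h : Function.Surjective ext) : IsStandardScheme (preimageEnc ext h) (extDec ext) := by
  intro s
  have h1 : (((preimageEnc ext h s).map (extDec ext)) (some s)).toReal = 1 := by
    have hsum : ∑ c, (preimageEnc ext h s c).toReal = 1 := by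
      rw [← ENNReal.toReal_sum fun c _ => (preimageEnc ext h s).apply_ne_top c,
        (tsum_fintype _).symm.trans (preimageEnc ext h s).tsum_coe, ENNReal.toReal_one]
    rw [toReal_map_apply, ← hsum]
    refine Finset.sum_congr rfl fun c _ => ?_
    rw [toReal_preimageEnc]
    by_cases hc : ext c = s <;> simp [extDec, hc]
  rwa [ENNReal.toReal_eq_one_iff] at h1

/-- Which of the `t` tampered codewords agree with the original one: `none` if `X ≠ X^i`, and otherwise
whether `Y = Y^i`. -/
def tamperClass (q : Bits n × Bits n × ((Fin t → Bits n) × N') × ((Fin t → Bits n) × M')) :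
    Fin t → Option Bool :=
  fun i => if q.1 = q.2.2.1.1 i then some (decide (q.2.1 = q.2.2.2.1 i)) else none

/-- The part of a class event that is decided by `X` and `X^[t]`. -/
def firstPred (c : Fin t → Option Bool) (x : Bits n) (u : (Fin t → Bits n) × N') : Prop :=
  ∀ i, c i = none ↔ x ≠ u.1 i

/-- The part of a class event that is decided by `Y` and `Y^[t]`. -/
def secondPred (c : Fin t → Option Bool) (y : Bits n) (v : (Fin t → Bits n) × M') : Prop :=
  ∀ i, (c i = some true → y = v.1 i) ∧ (c i = some false → y ≠ v.1 i)

omit [Fintype N'] [Fintype M'] in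
-- Three values are used because the event that the pair changed is not a product event; splitting
-- it by whether `X` changed makes every class a conjunction of one-sided conditions, which each
-- party can filter locally.
lemma tamperClass_eq_iff (c : Fin t → Option Bool)
    (q : Bits n × Bits n × ((Fin t → Bits n) × N') × ((Fin t → Bits n) × M')) :
    tamperClass q = c ↔ firstPred c q.1 q.2.2.1 ∧ secondPred c q.2.1 q.2.2.2 := by
  unfold firstPred secondPred
  rw [funext_iff, ← forall_and]
  refine forall_congr' fun i => ?_
  unfold tamperClass
  rcases hc : c i with _ | _ | _ <;> by_cases hx : q.1 = q.2.2.1.1 i <;>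
    by_cases hy : q.2.1 = q.2.2.2.1 i <;> simp [hx, hy]

/-- The weights of the tampering experiment on a uniform pair `(x, y)`. -/
def tamperWeight (U : Matrix ((Fin t → Bits n) × N') (Bits n × N) ℂ)
    (V : Matrix ((Fin t → Bits n) × M') (Bits n × M) ℂ) (ψ : N × M → ℂ)
    (q : Bits n × Bits n × ((Fin t → Bits n) × N') × ((Fin t → Bits n) × M')) : ℝ :=
  (4 ^ n)⁻¹ * ‖tamperAmp U V ψ q.1 q.2.1 q.2.2.1 q.2.2.2‖ ^ 2

variable [DecidableEq N] [DecidableEq M]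

lemma sum_norm_sq_tamperAmp {U : Matrix ((Fin t → Bits n) × N') (Bits n × N) ℂ}
    {V : Matrix ((Fin t → Bits n) × M') (Bits n × M) ℂ} {ψ : N × M → ℂ} (hU : IsIsometry U)
    (hV : IsIsometry V) (hψ : IsPureState ψ) (x y : Bits n) :
    ∑ u, ∑ v, ‖tamperAmp U V ψ x y u v‖ ^ 2 = 1 := by
  have h : ∀ u v, tamperAmp U V ψ x y u v = ∑ a, U u (x, a) * ∑ c, V v (y, c) * ψ (a, c) := by
    intro u v
    refine Finset.sum_congr rfl fun a _ => ?_
    rw [Finset.mul_sum]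
    exact Finset.sum_congr rfl fun c _ => by ring
  simp_rw [h]
  rw [Finset.sum_comm]
  simp_rw [hU.sum_norm_sq_slice x]
  rw [Finset.sum_comm]
  simp_rw [hV.sum_norm_sq_slice y]
  rw [← Fintype.sum_prod_type' (f := fun a c => ‖ψ (a, c)‖ ^ 2)]
  exact hψ

/-- Inserting the one-sided conditions into `U` and `V` gives contractions whose weights are `μ`
restricted to the class, so `sum_abs_output_le` applies. -/
lemma sum_abs_class_le (hn : 0 < n) {k ε : ℝ} {ext : Bits n × Bits n → Bits m}
    (hext : IsQuantumSecureNMExt t ((n : ℝ) - k) ((n : ℝ) - k) ε ext)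
    {U : Matrix ((Fin t → Bits n) × N') (Bits n × N) ℂ}
    {V : Matrix ((Fin t → Bits n) × M') (Bits n × M) ℂ} {ψ : N × M → ℂ} (hU : IsIsometry U)
    (hV : IsIsometry V) (hψ : IsPureState ψ) (c : Fin t → Option Bool)
    (hc : (2 : ℝ) ^ (-k) ≤ ∑ q, if tamperClass q = c then tamperWeight U V ψ q else 0) :
    ∑ s, ∑ w, |(∑ q : Bits n × Bits n × ((Fin t → Bits n) × N') × ((Fin t → Bits n) × M'),
        if ext (q.1, q.2.1) = s ∧
          copyTuple (maskSame c fun i => ext (q.2.2.1.1 i, q.2.2.2.1 i)) s = w then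
          (if tamperClass q = c then tamperWeight U V ψ q else 0) else 0) -
        (2 ^ m)⁻¹ * ∑ q : Bits n × Bits n × ((Fin t → Bits n) × N') × ((Fin t → Bits n) × M'),
          if copyTuple (maskSame c fun i => ext (q.2.2.1.1 i, q.2.2.2.1 i)) s = w then
          (if tamperClass q = c then tamperWeight U V ψ q else 0) else 0| ≤
      ε * ∑ q, if tamperClass q = c then tamperWeight U V ψ q else 0 := by
  classical
  set K : Bits n → Matrix ((Fin t → Bits n) × N') N ℂ := fun x =>
    Matrix.of fun u a => if firstPred c x u then U u (x, a) else 0 with hK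
  set L : Bits n → Matrix ((Fin t → Bits n) × M') M ℂ := fun y =>
    Matrix.of fun v b => if secondPred c y v then V v (y, b) else 0 with hL
  have hw : ∀ q, (if tamperClass q = c then tamperWeight U V ψ q else 0) = weight K L ψ q := by
    intro q
    by_cases h1 : firstPred c q.1 q.2.2.1 <;> by_cases h2 : secondPred c q.2.1 q.2.2.2 <;>
      simp [tamperClass_eq_iff, weight, tamperWeight, tamperAmp, hK, hL, h1, h2]
  simp_rw [hw] at hc ⊢
  -- Untouched indices would violate the no-fixed-point condition, so they are redirected to the
  -- complement of `x`; `maskSame` hides the changed outputs.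
  set g : Bits n → (Fin t → Bits n) × N' → Fin t → Bits n := fun x u i =>
    if c i = some true then fun j => !x j else u.1 i with hg
  set h : Bits n → (Fin t → Bits n) × M' → Fin t → Bits n := fun _ v => v.1 with hh
  have hmask : ∀ q : Bits n × Bits n × ((Fin t → Bits n) × N') × ((Fin t → Bits n) × M'),
      maskSame c (fun i => ext (q.2.2.1.1 i, q.2.2.2.1 i)) =
        maskSame c (fun i => ext (g q.1 q.2.2.1 i, h q.2.1 q.2.2.2 i)) := by
    intro q
    ext1 i
    by_cases hi : c i = some true <;> simp [maskSame, hg, hh, hi]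
  simp_rw [hmask]
  have hsupp : ∀ x y u v, weight K L ψ (x, y, u, v) ≠ 0 → firstPred c x u ∧ secondPred c y v := by
    intro x y u v hne
    rw [← hw] at hne
    exact (tamperClass_eq_iff c (x, y, u, v)).1 (by_contra fun hcon => hne (if_neg hcon))
  have hfix : ∀ i, (∀ x y u v, weight K L ψ (x, y, u, v) ≠ 0 → y ≠ h y v i) ∨
      (∀ x y u v, weight K L ψ (x, y, u, v) ≠ 0 → x ≠ g x u i) := by
    intro i
    rcases hi : c i with _ | _ | _
    · right
      intro x y u v hne
      simpa [hg, hi] using ((hsupp x y u v hne).1 i).1 hi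
    · left
      intro x y u v hne
      exact ((hsupp x y u v hne).2 i).2 hi
    · right
      intro x y u v _ hx
      have := congrFun hx ⟨0, hn⟩
      simp [hg, hi] at this
  have hkey := sum_abs_output_le hext (K := K) (L := L) (fun x => hU.isContraction_slice x _)
    (fun y => hV.isContraction_slice y _) hψ hc hfix
  have hcoarse := sum_abs_joint_sub_product_le (2 ^ m : ℝ)⁻¹
    (fun q : Bits n × Bits n × ((Fin t → Bits n) × N') × ((Fin t → Bits n) × M') =>
      ext (q.1, q.2.1))
    (fun q => fun i => ext (g q.1 q.2.2.1 i, h q.2.1 q.2.2.2 i))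
    (fun s ss => copyTuple (maskSame c ss) s) (weight K L ψ)
  exact hcoarse.trans hkey

end Code

/-! ### Comparison of encoded messages with uniform pairs -/

section Assembly

variable {n m t : ℕ} {N M N' M' : Type} [Fintype N] [Fintype M] [Fintype N'] [Fintype M']

lemma sum_fiber_comp {Q K W : Type} [Fintype Q] [Fintype K] [DecidableEq K] [DecidableEq W]
    (f : Q → K) (F : K → W) (μ : Q → ℝ) (w : W) :
    (∑ d, if F d = w then ∑ q, if f q = d then μ q else 0 else 0) =
      ∑ q, if F (f q) = w then μ q else 0 := by
  have h : ∀ d, (if F d = w then ∑ q, if f q = d then μ q else 0 else 0) =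
      ∑ q, if f q = d then (if F d = w then μ q else 0) else 0 := by
    intro d
    split_ifs <;> simp
  simp_rw [h]
  rw [Finset.sum_comm]
  simp

lemma sum_fiberCard_mul (ext : Bits n × Bits n → Bits m) (φ : Bits m → ℝ) :
    ∑ c, φ (ext c) = ∑ s, fiberCard ext s * φ s := by
  have h : ∀ s, (fiberCard ext s : ℝ) * φ s = ∑ c, if ext c = s then φ s else 0 := by
    intro s
    rw [fiberCard, Finset.card_filter]
    push_cast
    rw [Finset.sum_mul]
    simp
  simp_rw [h]
  rw [Finset.sum_comm]
  simp

lemma traceNorm_decodedState_sub_simulatedState (Enc : Bits m → PMF (Bits n × Bits n))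
    (Dec : Bits n × Bits n → Option (Bits m))
    (U : Matrix ((Fin t → Bits n) × N') (Bits n × N) ℂ)
    (V : Matrix ((Fin t → Bits n) × M') (Bits n × M) ℂ) (ψ : N × M → ℂ)
    (D : PMF (Fin t → Option (Bits m))) :
    traceNorm (decodedState Dec (tamperedState Enc U V ψ) - simulatedState D) =
      ∑ s, ∑ w, |(∑ xs, ∑ ys, ∑ a, ∑ c, if (fun i => Dec (xs i, ys i)) = w then
        ∑ x, ∑ y, (2 ^ m)⁻¹ * (Enc s (x, y)).toReal *
          ‖tamperAmp U V ψ x y (xs, a) (ys, c)‖ ^ 2 else 0) -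
        (2 ^ m)⁻¹ * ∑ d, if copyTuple d s = w then (D d).toReal else 0| := by
  rw [decodedState_tamperedState, simulatedState, classicalState, Matrix.diagonal_sub]
  simp_rw [← Complex.ofReal_sub]
  rw [traceNorm_diagonal, Fintype.sum_prod_type]
  simp_rw [toReal_simulated_apply]

/-- The weights of the tampering experiment on the encoding of a uniform message. -/
def codeWeight (ext : Bits n × Bits n → Bits m)
    (U : Matrix ((Fin t → Bits n) × N') (Bits n × N) ℂ)
    (V : Matrix ((Fin t → Bits n) × M') (Bits n × M) ℂ) (ψ : N × M → ℂ)
    (q : Bits n × Bits n × ((Fin t → Bits n) × N') × ((Fin t → Bits n) × M')) : ℝ :=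
  (2 ^ m)⁻¹ * 4 ^ n * (fiberCard ext (ext (q.1, q.2.1)) : ℝ)⁻¹ * tamperWeight U V ψ q

lemma sum_decoded_eq_sum_codeWeight (ext : Bits n × Bits n → Bits m)
    (hsurj : Function.Surjective ext)
    (U : Matrix ((Fin t → Bits n) × N') (Bits n × N) ℂ)
    (V : Matrix ((Fin t → Bits n) × M') (Bits n × M) ℂ) (ψ : N × M → ℂ) (s : Bits m)
    (w : Fin t → Option (Bits m)) :
    (∑ xs, ∑ ys, ∑ a, ∑ c, if (fun i => extDec ext (xs i, ys i)) = w then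
        ∑ x, ∑ y, (2 ^ m)⁻¹ * (preimageEnc ext hsurj s (x, y)).toReal *
          ‖tamperAmp U V ψ x y (xs, a) (ys, c)‖ ^ 2 else 0) =
      ∑ q : Bits n × Bits n × ((Fin t → Bits n) × N') × ((Fin t → Bits n) × M'),
        if ext (q.1, q.2.1) = s ∧ (fun i => some (ext (q.2.2.1.1 i, q.2.2.2.1 i))) = w then
          codeWeight ext U V ψ q else 0 := by
  let e : ((Fin t → Bits n) × (Fin t → Bits n) × N' × M' × Bits n × Bits n) ≃
      (Bits n × Bits n × ((Fin t → Bits n) × N') × ((Fin t → Bits n) × M')) :=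
    ⟨fun p => (p.2.2.2.2.1, p.2.2.2.2.2, (p.1, p.2.2.1), (p.2.1, p.2.2.2.1)),
      fun q => (q.2.2.1.1, q.2.2.2.1, q.2.2.1.2, q.2.2.2.2, q.1, q.2.1),
      fun _ => rfl, fun _ => rfl⟩
  rw [← e.sum_comp]
  simp_rw [Fintype.sum_prod_type]
  refine Finset.sum_congr rfl fun xs _ => Finset.sum_congr rfl fun ys _ =>
    Finset.sum_congr rfl fun a _ => Finset.sum_congr rfl fun c _ => ?_
  simp only [e, Equiv.coe_fn_mk]
  by_cases hw : (fun i => extDec ext (xs i, ys i)) = w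
  · rw [if_pos hw]
    refine Finset.sum_congr rfl fun x _ => Finset.sum_congr rfl fun y _ => ?_
    rw [toReal_preimageEnc]
    by_cases hs : ext (x, y) = s
    · rw [if_pos hs, if_pos (show ext (x, y) = s ∧ (fun i => some (ext (xs i, ys i))) = w from ⟨hs, hw⟩)]
      simp only [codeWeight, tamperWeight, hs]
      field_simp
    · rw [if_neg hs, if_neg (show ¬(ext (x, y) = s ∧ (fun i => some (ext (xs i, ys i))) = w) from
        fun h => hs h.1)]
      simp
  · rw [if_neg hw]
    exact (Finset.sum_eq_zero fun x _ => Finset.sum_eq_zero fun y _ =>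
      if_neg fun h => hw h.2).symm

omit [Fintype N'] [Fintype M'] in
lemma tamperWeight_nonneg (U : Matrix ((Fin t → Bits n) × N') (Bits n × N) ℂ)
    (V : Matrix ((Fin t → Bits n) × M') (Bits n × M) ℂ) (ψ : N × M → ℂ)
    (q : Bits n × Bits n × ((Fin t → Bits n) × N') × ((Fin t → Bits n) × M')) :
    0 ≤ tamperWeight U V ψ q := by
  unfold tamperWeight
  positivity

variable [DecidableEq N] [DecidableEq M]

lemma sum_mul_tamperWeight {U : Matrix ((Fin t → Bits n) × N') (Bits n × N) ℂ}
    {V : Matrix ((Fin t → Bits n) × M') (Bits n × M) ℂ} {ψ : N × M → ℂ} (hU : IsIsometry U)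
    (hV : IsIsometry V) (hψ : IsPureState ψ) (φ : Bits n × Bits n → ℝ) :
    ∑ q, φ (q.1, q.2.1) * tamperWeight U V ψ q = (4 ^ n)⁻¹ * ∑ c, φ c := by
  rw [Fintype.sum_prod_type, Fintype.sum_prod_type, Finset.mul_sum]
  refine Finset.sum_congr rfl fun x _ => ?_
  rw [Fintype.sum_prod_type, Finset.mul_sum]
  refine Finset.sum_congr rfl fun y _ => ?_
  rw [Fintype.sum_prod_type]
  simp_rw [tamperWeight, ← Finset.mul_sum]
  rw [sum_norm_sq_tamperAmp hU hV hψ]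
  ring

/-- The ratio of the two weights depends only on `ext (x, y)`. Since `μ` gives the fibre of `s` mass
`4 ^ (-n) * fiberCard ext s`, summing over fibres yields exactly the distance of `ext (X, Y)` from
uniform. -/
lemma sum_abs_codeWeight_sub_le (hn : 0 < n) {k ε : ℝ} (hk : 0 < k)
    {ext : Bits n × Bits n → Bits m} (hsurj : Function.Surjective ext)
    (hext : IsQuantumSecureNMExt t ((n : ℝ) - k) ((n : ℝ) - k) ε ext)
    {U : Matrix ((Fin t → Bits n) × N') (Bits n × N) ℂ}
    {V : Matrix ((Fin t → Bits n) × M') (Bits n × M) ℂ} {ψ : N × M → ℂ} (hU : IsIsometry U)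
    (hV : IsIsometry V) (hψ : IsPureState ψ) :
    ∑ q, |codeWeight ext U V ψ q - tamperWeight U V ψ q| ≤ ε := by
  refine le_trans (le_of_eq ?_) (sum_abs_fiberCard_sub_le hn hk hext)
  have h : ∀ q, |codeWeight ext U V ψ q - tamperWeight U V ψ q| =
      |(2 ^ m)⁻¹ * 4 ^ n * (fiberCard ext (ext (q.1, q.2.1)) : ℝ)⁻¹ - 1| *
        tamperWeight U V ψ q := by
    intro q
    rw [codeWeight, ← sub_one_mul, abs_mul, abs_of_nonneg (tamperWeight_nonneg U V ψ q)]
  simp_rw [h]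
  rw [sum_mul_tamperWeight hU hV hψ
    (fun c => |(2 ^ m)⁻¹ * 4 ^ n * (fiberCard ext (ext c) : ℝ)⁻¹ - 1|),
    sum_fiberCard_mul ext (fun s => |(2 ^ m)⁻¹ * 4 ^ n * (fiberCard ext s : ℝ)⁻¹ - 1|),
    Finset.mul_sum]
  refine Finset.sum_congr rfl fun s _ => ?_
  obtain ⟨c, hc⟩ := hsurj s
  have hpos : (0 : ℝ) < fiberCard ext s := by
    exact_mod_cast Finset.card_pos.2 ⟨c, by simp [hc]⟩
  rw [← abs_of_pos hpos, ← abs_mul, abs_of_pos hpos,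
    ← abs_of_pos (show (0 : ℝ) < (4 ^ n)⁻¹ by positivity), ← abs_mul,
    abs_of_pos (show (0 : ℝ) < (4 ^ n)⁻¹ by positivity), abs_sub_comm]
  congr 1
  field_simp

lemma sum_codeWeight_fiber {ext : Bits n × Bits n → Bits m} (hsurj : Function.Surjective ext)
    {U : Matrix ((Fin t → Bits n) × N') (Bits n × N) ℂ}
    {V : Matrix ((Fin t → Bits n) × M') (Bits n × M) ℂ} {ψ : N × M → ℂ} (hU : IsIsometry U)
    (hV : IsIsometry V) (hψ : IsPureState ψ) (s : Bits m) :
    (∑ q, if ext (q.1, q.2.1) = s then codeWeight ext U V ψ q else 0) = (2 ^ m)⁻¹ := by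
  have h : ∀ q, (if ext (q.1, q.2.1) = s then codeWeight ext U V ψ q else 0) =
      (if ext (q.1, q.2.1) = s then (2 ^ m)⁻¹ * 4 ^ n * (fiberCard ext s : ℝ)⁻¹ else 0) *
        tamperWeight U V ψ q := by
    intro q
    by_cases hs : ext (q.1, q.2.1) = s <;> simp [codeWeight, hs]
  simp_rw [h]
  rw [sum_mul_tamperWeight hU hV hψ
    (fun c => if ext c = s then (2 ^ m)⁻¹ * 4 ^ n * (fiberCard ext s : ℝ)⁻¹ else 0),
    sum_fiberCard_mul ext
      (fun s' => if s' = s then (2 ^ m)⁻¹ * 4 ^ n * (fiberCard ext s : ℝ)⁻¹ else 0)]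
  obtain ⟨c, hc⟩ := hsurj s
  have hpos : (0 : ℝ) < fiberCard ext s := by
    exact_mod_cast Finset.card_pos.2 ⟨c, by simp [hc]⟩
  simp only [mul_ite, mul_zero, Finset.sum_ite_eq', Finset.mem_univ, if_true]
  field_simp

end Assembly

end SplitState

end

theorem mainTheorem4 (n m t : ℕ) (hn : 0 < n) (hm : 0 < m) (ht : 0 < t)
    (k ε : ℝ) (hk : 0 < k) (hε : 0 < ε)
    (ext : SplitState.Bits n × SplitState.Bits n → SplitState.Bits m)
    (hsurj : Function.Surjective ext)
    (hext : SplitState.IsQuantumSecureNMExt t ((n : ℝ) - k) ((n : ℝ) - k) ε ext) :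
    SplitState.IsQuantumSecureNMCode t ((2 : ℝ) ^ (2 * t) * ((2 : ℝ) ^ (-k) + ε) + ε)
      (SplitState.preimageEnc ext hsurj) (SplitState.extDec ext) := by
  open SplitState in
  refine ⟨isStandardScheme_preimageEnc ext hsurj, ?_⟩
  intro N M N' M' _ _ _ _ _ _ _ _ U V ψ hU hV hψ
  have hδ : (0 : ℝ) ≤ 2 ^ (-k) := (Real.rpow_pos_of_pos two_pos _).le
  have hμ := tamperWeight_nonneg U V ψ
  have hμ1 : ∑ q, tamperWeight U V ψ q = 1 := by
    have h := sum_mul_tamperWeight hU hV hψ fun _ => 1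
    have h4 : (4 : ℝ) ^ n = 2 ^ n * 2 ^ n := by
      rw [← mul_pow]
      norm_num
    have hcard : ∑ _c : Bits n × Bits n, (1 : ℝ) = 4 ^ n := by simp [h4]
    rw [hcard, inv_mul_cancel₀ (by positivity)] at h
    simpa using h
  have hν : ∀ q, 0 ≤ codeWeight ext U V ψ q := fun q => by
    have := hμ q
    unfold codeWeight
    positivity
  have hswap := sum_abs_codeWeight_sub_le hn hk hsurj hext hU hV hψ
  have hsame : ∀ (q : Bits n × Bits n × ((Fin t → Bits n) × N') × ((Fin t → Bits n) × M')) i,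
      tamperClass q i = some true → ext (q.2.2.1.1 i, q.2.2.2.1 i) = ext (q.1, q.2.1) := by
    intro q i hi
    unfold tamperClass at hi
    by_cases hx : q.1 = q.2.2.1.1 i
    · have hy : q.2.1 = q.2.2.2.1 i := by simpa [hx] using hi
      rw [← hx, ← hy]
    · simp [hx] at hi
  simp_rw [traceNorm_decodedState_sub_simulatedState, sum_decoded_eq_sum_codeWeight]
  -- Either case spares one class from the count: a heavy one here, the all-`same` one otherwise.
  by_cases hex : ∃ c : Fin t → Option Bool,
      (2 : ℝ) ^ (-k) ≤ ∑ q, if tamperClass q = c then tamperWeight U V ψ q else 0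
  · have hp : ∑ q, ENNReal.ofReal (tamperWeight U V ψ q) = 1 := by
      rw [← ENNReal.ofReal_sum_of_nonneg fun q _ => hμ q, hμ1, ENNReal.ofReal_one]
    -- The simulator runs the tampering on a uniform pair, so its distribution does not involve the
    -- message.
    refine ⟨(PMF.ofFintype (fun q => ENNReal.ofReal (tamperWeight U V ψ q)) hp).map
      fun q => maskSame (tamperClass q) fun i => ext (q.2.2.1.1 i, q.2.2.2.1 i), ?_⟩
    have hD : ∀ s w, (∑ d, if copyTuple d s = w then
        (((PMF.ofFintype (fun q => ENNReal.ofReal (tamperWeight U V ψ q)) hp).map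
          fun q => maskSame (tamperClass q) fun i => ext (q.2.2.1.1 i, q.2.2.2.1 i)) d).toReal
          else 0) =
        ∑ q, if copyTuple (maskSame (tamperClass q) fun i => ext (q.2.2.1.1 i, q.2.2.2.1 i)) s = w
          then tamperWeight U V ψ q else 0 := by
      intro s w
      simp_rw [toReal_map_apply, toReal_ofFintype_apply hμ hp]
      exact sum_fiber_comp _ _ _ w
    simp_rw [hD]
    exact sum_abs_sub_simulated_le_of_class hμ hμ1 hε.le hδ ht hsame hswap
      (fun c hc => sum_abs_class_le hn hext hU hV hψ c hc) hex
  · push Not at hex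
    refine ⟨PMF.pure fun _ => none, ?_⟩
    have hD : ∀ s w, (∑ d, if copyTuple d s = w then
        ((PMF.pure (fun _ => none) : PMF (Fin t → Option (Bits m))) d).toReal else 0) =
        if (copyTuple (fun _ => none) s : Fin t → Option (Bits m)) = w then 1 else 0 := by
      intro s w
      rw [Finset.sum_eq_single fun _ => none]
      · simp
      · intro d _ hd
        simp [hd]
      · simp
    simp_rw [hD]
    exact sum_abs_sub_same_le_of_class hν hε.le hδ ht hsame hswap
      (sum_codeWeight_fiber hsurj hU hV hψ) hex
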